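/- All C$^*$-algebras below are unital. A \emph{Popa algebra} is a simple (in particular nonzero), separable, unital C$^*$-algebra $A$ such that for every finite subset $F\subset A$ and every $\varepsilon>0$ there is a nonzero finite dimensional C$^*$-subalgebra $B\subset A$ with unit $e$ (not necessarily the unit of $A$) such that $\|ex-xe\|\le\varepsilon$ for all $x\in F$, and for each $x\in F$ there is $b\in B$ with $\|exe-b\|\le\varepsilon$. A C$^*$-algebra $E$ is \emph{residually finite dimensional} if for every $0\neq x\in E$ there are $n\in\mathbb N$ and a $*$-homomorphism $\pi:E\to M_n(\mathbb C)$ with $\pi(x)\neq 0$. For a C$^*$-algebra $A$, $\mathrm T(A)$ is the set of tracial states of $A$; for $\tau\in\mathrm T(A)$, $\pi_\tau$ is the GNS representation and $\pi_\tau(A)''$ the von Neumann algebra that it generates on $L^2(A,\tau)$. $R$ denotes the hyperfinite II$_1$ factor, $\bar\otimes$ the von Neumann algebra tensor product, and $\cong$ denotes $*$-isomorphism of von Neumann algebras. \textbf{Theorem.} Let $\mathfrak C$ be a class of C$^*$-algebras which is closed under increasing unions (that is, under inductive limits of sequences with injective unital connecting maps; in particular $\mathfrak C$ is closed under isomorphism)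 and under tensoring with the matrix algebras $M_n(\mathbb C)$, $n\ge 1$. Let $E\in\mathfrak C$ be a nonzero, separable, residually finite dimensional C$^*$-algebra. Then there exists a Popa algebra $A\in\mathfrak C$ such that for every $\varepsilon>0$ there is a unital $*$-monomorphism $\rho:E\hookrightarrow A$ with the following property: for each $\tau\in\mathrm T(E)$ there exists $\gamma\in\mathrm T(A)$ such that \begin{enumerate} \item $|\gamma(\rho(x))-\tau(x)|<\varepsilon\|x\|$ for all $0\neq x\in E$, and \item $\pi_\gamma(A)''\cong R\,\bar\otimes\,\pi_\tau(E)''$. \end{enumerate} -/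

import Mathlib

open scoped ComplexOrder TensorProduct symmDiff

universe u v

/-! ## Residually finite dimensional and Popa algebras -/

/-- A C⋆-algebra is residually finite dimensional if its finite dimensional representations
separate its points. -/
def IsResiduallyFiniteDimensional (E : Type u) [CStarAlgebra E] : Prop :=
  ∀ x : E, x ≠ 0 → ∃ (n : ℕ) (π : E →⋆ₙₐ[ℂ] Matrix (Fin n) (Fin n) ℂ), π x ≠ 0

/-- A unital C⋆-algebra is simple if it is nonzero and has no closed two-sided ideals other than
zero and the whole algebra. -/
def IsSimpleCStarAlgebra (A : Type u) [CStarAlgebra A] : Prop :=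
  Nontrivial A ∧ ∀ I : TwoSidedIdeal A, IsClosed (I : Set A) → I = ⊥ ∨ I = ⊤

/-- A Popa algebra is a simple, separable, unital C⋆-algebra `A` such that for every finite subset
`F` and every `ε > 0` there is a nonzero finite dimensional C⋆-subalgebra `B` of `A`, with unit `e`,
such that `‖e x - x e‖ ≤ ε` for all `x ∈ F` and every `e x e`, `x ∈ F`, is within `ε` of `B`.
(The unit `e` of `B` need not be the unit of `A`, and `B ≠ 0` means that `e ≠ 0`.) -/
structure IsPopaAlgebra (A : Type u) [CStarAlgebra A] : Prop where
  simple : IsSimpleCStarAlgebra A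
  separable : TopologicalSpace.SeparableSpace A
  finite_dimensional_approximation : ∀ (F : Finset A) (ε : ℝ), 0 < ε →
    ∃ (B : NonUnitalStarSubalgebra ℂ A) (e : A),
      FiniteDimensional ℂ B ∧ e ≠ 0 ∧ e ∈ B ∧ (∀ b ∈ B, e * b = b ∧ b * e = b) ∧
      (∀ x ∈ F, ‖e * x - x * e‖ ≤ ε) ∧
      (∀ x ∈ F, ∃ b ∈ B, ‖e * x * e - b‖ ≤ ε)

/-! ## Closure properties of a class of C⋆-algebras -/

/-- The class `C` is closed under increasing unions: if `A` is the inductive limit of a sequence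
`B 0 ⊆ B 1 ⊆ ⋯` of members of `C` with injective (unital) connecting maps, then `A` belongs to `C`.
Here the embeddings `j n : B n → A` have increasing ranges whose union is dense in `A`. -/
def ClosedUnderIncreasingUnions (C : ∀ (B : Type u) [CStarAlgebra B], Prop) : Prop :=
  ∀ (B : ℕ → Type u) [∀ n, CStarAlgebra (B n)] (A : Type u) [CStarAlgebra A]
    (j : ∀ n, B n →⋆ₐ[ℂ] A),
    (∀ n, Function.Injective (j n)) →
    (∀ n, Set.range (j n) ⊆ Set.range (j (n + 1))) →
    Dense (⋃ n, Set.range (j n)) →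
    (∀ n, C (B n)) → C A

/-- The class `C` is closed under tensoring with the matrix algebras `M_n(ℂ)`, `n ≥ 1`; the tensor
product of `B` with `M_n(ℂ)` is the C⋆-algebra of `n × n` matrices over `B`. (The order on `B` is
the usual order of a C⋆-algebra, which `StarOrderedRing` determines uniquely.) -/
def ClosedUnderMatrixTensoring (C : ∀ (B : Type u) [CStarAlgebra B], Prop) : Prop :=
  ∀ (B : Type u) [CStarAlgebra B] [PartialOrder B] [StarOrderedRing B] (n : ℕ), 1 ≤ n →
    C B → C (CStarMatrix (Fin n) (Fin n) B)

/-! ## Von Neumann algebras -/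

section VonNeumann

variable {H : Type u} [NormedAddCommGroup H] [InnerProductSpace ℂ H] [CompleteSpace H]
variable {K : Type v} [NormedAddCommGroup K] [InnerProductSpace ℂ K] [CompleteSpace K]

/-- The von Neumann algebra generated by a set of bounded operators: the double commutant of
the set together with the adjoints of its elements. -/
noncomputable def vonNeumannAlgebraGenerated (S : Set (H →L[ℂ] H)) : VonNeumannAlgebra H where
  toStarSubalgebra :=
    StarSubalgebra.centralizer ℂ (Set.centralizer (S ∪ star S) : Set (H →L[ℂ] H))
  centralizer_centralizer' := by
    simp

variable (H K) in
/-- The Hilbert space tensor product. -/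
abbrev HilbertTensor : Type (max u v) := UniformSpace.Completion (H ⊗[ℂ] K)

/-- The bounded operator `x ⊗ y` on the Hilbert space tensor product. -/
noncomputable def operatorTensor (x : H →L[ℂ] H) (y : K →L[ℂ] K) :
    HilbertTensor H K →L[ℂ] HilbertTensor H K :=
  (TensorProduct.mapL x y).completion

/-- The von Neumann algebra tensor product of `M ⊆ B(H)` and `N ⊆ B(K)`: the von Neumann algebra
on the Hilbert space tensor product generated by the `x ⊗ y` with `x ∈ M` and `y ∈ N`. -/
noncomputable def VonNeumannAlgebra.tensor (M : VonNeumannAlgebra H) (N : VonNeumannAlgebra K) :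
    VonNeumannAlgebra (HilbertTensor H K) :=
  vonNeumannAlgebraGenerated {T | ∃ x ∈ M, ∃ y ∈ N, T = operatorTensor x y}

/-- Isomorphism of von Neumann algebras, as `⋆`-algebras (a `⋆`-isomorphism between von Neumann
algebras is automatically normal). -/
def VonNeumannAlgebra.Isomorphic (M : VonNeumannAlgebra H) (N : VonNeumannAlgebra K) : Prop :=
  Nonempty (M.toStarSubalgebra ≃⋆ₐ[ℂ] N.toStarSubalgebra)

end VonNeumann

/-! ## Tracial states and their GNS von Neumann algebras -/

/-- A tracial state on a unital C⋆-algebra: a positive linear functional `τ` with `τ 1 = 1` and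
`τ (x y) = τ (y x)`. -/
structure TracialState (A : Type u) [CStarAlgebra A] [PartialOrder A] [StarOrderedRing A] where
  /-- The underlying positive linear functional. -/
  toFunctional : A →ₚ[ℂ] ℂ
  map_one : toFunctional 1 = 1
  map_mul_comm : ∀ x y, toFunctional (x * y) = toFunctional (y * x)

/-- The von Neumann algebra `π_τ(A)''` on the GNS Hilbert space `L²(A, τ)`. -/
noncomputable def TracialState.gnsVonNeumannAlgebra {A : Type u} [CStarAlgebra A] [PartialOrder A]
    [StarOrderedRing A] (τ : TracialState A) : VonNeumannAlgebra τ.toFunctional.GNS :=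
  vonNeumannAlgebraGenerated (Set.range τ.toFunctional.gnsStarAlgHom)

/-! ## The hyperfinite II₁ factor

`R` is realised as the weak closure of the CAR algebra `⨂_ℕ M₂(ℂ)` in the GNS representation of its
tracial state. Let `X j` and `Z j` be the Pauli matrices `!![0, 1; 1, 0]` and `!![1, 0; 0, -1]` in
the `j`-th tensor factor. The monomials `X^S Z^T = (∏ j ∈ S, X j) * (∏ j ∈ T, Z j)`, for finite
`S, T ⊆ ℕ`, form an orthonormal basis of `L²(⨂_ℕ M₂(ℂ), tr)`, which is thereby identified with
`ℓ²(Finset ℕ × Finset ℕ)`. Left multiplication by `X j` sends `X^S Z^T` to `X^(S ∆ {j}) Z^T`,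
and left multiplication by `Z j` sends it to `(-1)^[j ∈ S] X^S Z^(T ∆ {j})`. -/

/-- The Hilbert space `L²(⨂_ℕ M₂(ℂ), tr)`, in the orthonormal basis of the Pauli monomials. -/
abbrev PauliSpace : Type := lp (fun _ : Finset ℕ × Finset ℕ => ℂ) 2

/-- The unitary operator `(U f) i = c i * f (e i)` on `ℓ²(ι)`, for a permutation `e` of `ι` and
numbers `c i` of modulus one. -/
noncomputable def weightedPermutation {ι : Type} (e : Equiv.Perm ι) (c : ι → ℂ)
    (hc : ∀ i, ‖c i‖ = 1) :
    lp (fun _ : ι => ℂ) 2 →L[ℂ] lp (fun _ : ι => ℂ) 2 :=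
  LinearIsometry.toContinuousLinearMap
    { toFun := fun f => ⟨fun i => c i * f (e i), by
        have h := (memℓp_gen_iff (by norm_num : 0 < (2 : ENNReal).toReal)).1 f.2
        refine memℓp_gen ?_
        simpa [hc, Function.comp_def] using e.summable_iff.2 h⟩
      map_add' := fun f g => by
        ext i
        exact mul_add (c i) (f (e i)) (g (e i))
      map_smul' := fun a f => by
        ext i
        simp [mul_left_comm]
      norm_map' := fun f => by
        have h2 : 0 < (2 : ENNReal).toReal := by norm_num
        rw [lp.norm_eq_tsum_rpow h2, lp.norm_eq_tsum_rpow h2]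
        congr 1
        rw [← e.tsum_eq (fun i => ‖f i‖ ^ (2 : ENNReal).toReal)]
        simp [hc] }

/-- The involution `S ↦ S ∆ {j}` of the finite subsets of `ℕ`. -/
def flipAt (j : ℕ) : Equiv.Perm (Finset ℕ) :=
  Function.Involutive.toPerm (fun S => S ∆ {j}) (fun S => symmDiff_symmDiff_cancel_right {j} S)

/-- Left multiplication by `X j`. -/
noncomputable def pauliX (j : ℕ) : PauliSpace →L[ℂ] PauliSpace :=
  weightedPermutation (Equiv.prodCongr (flipAt j) (Equiv.refl (Finset ℕ))) (fun _ => 1) (by simp)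

/-- Left multiplication by `Z j`. -/
noncomputable def pauliZ (j : ℕ) : PauliSpace →L[ℂ] PauliSpace :=
  weightedPermutation (Equiv.prodCongr (Equiv.refl (Finset ℕ)) (flipAt j))
    (fun p => if j ∈ p.1 then -1 else 1) (fun p => by split_ifs <;> simp)

/-- The hyperfinite II₁ factor `R`. -/
noncomputable def hyperfiniteFactor : VonNeumannAlgebra PauliSpace :=
  vonNeumannAlgebraGenerated (Set.range pauliX ∪ Set.range pauliZ)

open Filter Topology
open scoped ENNReal

/-!
The algebra is a limit of matrix algebras `A m` over `E`, where `A (m + 1)` consists of matrices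
over `A m` and the connecting map is `x ↦ π m x + (1 - π m 1) * diag(x, …, x)`, for a
finite-dimensional representation `π m` of `A m` by scalar matrices which at most halves norms on a
given finite set but occupies only a corner `π m 1` of normalised trace at most `(1 / 4) ^ (m + 1)`.
The images of `π m` are almost central finite-dimensional corners, which gives the Popa property,
and a nonzero closed ideal cannot avoid them because of the norm bound, which gives simplicity.

For a trace `τ` of `E`, each `A m` acts on `L²(R) ⊗ L²(E, τ)` as matrix units of `R` tensored with
`π_τ(E)`. The connecting map differs from the amplification only on the corner `π m 1`, which has
small trace, so these actions converge strongly to a representation of the limit with the same trace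
vector. Its range has the same commutant as `R` and `π_τ(E)` together, and therefore generates
`R ⊗̄ π_τ(E)''`; uniqueness of the GNS representation identifies this algebra with `π_γ(A)''`.
Embedding `E` as constant diagonals at a late stage leaves only a short tail of the limit to distort
`τ`, whence `ε`.
-/

section Splice

variable {R A B : Type*} [CommSemiring R] [Ring A] [StarRing A] [Algebra R A]
  [Ring B] [StarRing B] [Algebra R B]

theorem map_one_mul_map (f : A →⋆ₙₐ[R] B) (x : A) : f 1 * f x = f x := by
  rw [← map_mul, one_mul]

theorem map_mul_map_one (f : A →⋆ₙₐ[R] B) (x : A) : f x * f 1 = f x := by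
  rw [← map_mul, mul_one]

/-- The unital `⋆`-homomorphism `x ↦ f x + (1 - f 1) * g x`, which follows `f` under the projection
`f 1` and `g` under its complement. -/
def splice (f : A →⋆ₙₐ[R] B) (g : A →⋆ₐ[R] B) (h : ∀ x, Commute (f 1) (g x)) : A →⋆ₐ[R] B where
  toFun x := f x + (1 - f 1) * g x
  map_one' := by simp
  map_mul' x y := by
    have hproj : (1 - f 1) * (1 - f 1) = 1 - f 1 := by
      simp only [sub_mul, mul_sub, one_mul, mul_one, map_one_mul_map, sub_self, sub_zero]
    have hleft : f x * ((1 - f 1) * g y) = 0 := by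
      rw [← mul_assoc, mul_sub, mul_one, map_mul_map_one, sub_self, zero_mul]
    have hright : (1 - f 1) * g x * f y = 0 := by
      rw [((Commute.one_left _).sub_left (h x)).eq, mul_assoc, sub_mul, one_mul, map_one_mul_map,
        sub_self, mul_zero]
    have hcorner : (1 - f 1) * g x * ((1 - f 1) * g y) = (1 - f 1) * g (x * y) := by
      rw [((Commute.one_left _).sub_left (h x)).eq, mul_assoc, ← mul_assoc (1 - f 1), hproj,
        ← mul_assoc, ← ((Commute.one_left _).sub_left (h x)).eq, mul_assoc, map_mul]
    rw [add_mul, mul_add, mul_add, hleft, hright, hcorner, map_mul, add_zero, zero_add]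
  map_zero' := by simp
  map_add' x y := by simp only [map_add, mul_add]; abel
  commutes' r := by
    rw [AlgHomClass.commutes g, Algebra.algebraMap_eq_smul_one, map_smul,
      Algebra.algebraMap_eq_smul_one, mul_smul_comm, mul_one, smul_sub, add_sub_cancel]
  map_star' x := by
    have hone : star (f 1) = f 1 := by rw [← map_star, star_one]
    rw [star_add, star_mul, star_sub, star_one, hone, ← map_star, ← map_star,
      ((Commute.one_left _).sub_left (h (star x))).eq]

variable (f : A →⋆ₙₐ[R] B) (g : A →⋆ₐ[R] B) (h : ∀ x, Commute (f 1) (g x))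

theorem splice_apply (x : A) : splice f g h x = f x + (1 - f 1) * g x := rfl

theorem map_one_mul_splice (x : A) : f 1 * splice f g h x = f x := by
  rw [splice_apply, mul_add, ← mul_assoc, mul_sub, mul_one, map_one_mul_map, map_one_mul_map,
    sub_self, zero_mul, add_zero]

theorem splice_mul_map_one (x : A) : splice f g h x * f 1 = f x := by
  rw [splice_apply, add_mul, mul_assoc, ← (h x).eq, ← mul_assoc, sub_mul, one_mul, map_one_mul_map,
    map_mul_map_one, sub_self, zero_mul, add_zero]

theorem splice_sub (x : A) : splice f g h x - g x = (f x - g x) * f 1 := by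
  rw [splice_apply, sub_mul _ _ (f 1), map_mul_map_one, ← (h x).eq, sub_mul, one_mul]
  abel

end Splice

section ConnectingMap

variable {n : Type*} [Fintype n] [DecidableEq n]
  {A : Type*} [Ring A] [StarRing A] [Algebra ℂ A]

variable (n A) in
/-- The amplification `x ↦ diag(x, …, x)`. -/
def matrixAmplification : A →⋆ₐ[ℂ] CStarMatrix n n A where
  __ := Matrix.scalarAlgHom n ℂ
  map_star' x := (Matrix.diagonal_conjTranspose fun _ : n => x).symm

theorem matrixAmplification_apply (x : A) (i j : n) :
    matrixAmplification n A x i j = if i = j then x else 0 := rfl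

theorem mul_matrixAmplification_apply (x : A) (y : CStarMatrix n n A) (i j : n) :
    (y * matrixAmplification n A x) i j = y i j * x := by
  simp [CStarMatrix.mul_apply, matrixAmplification_apply]

variable [StarModule ℂ A]

variable (n A) in
/-- The inclusion of the complex matrices in the matrices over `A`. -/
def scalarMatrix : CStarMatrix n n ℂ →⋆ₐ[ℂ] CStarMatrix n n A where
  __ := (Algebra.ofId ℂ A).mapMatrix
  map_star' x := by
    ext i j
    exact algebraMap_star_comm _

theorem scalarMatrix_apply (T : CStarMatrix n n ℂ) (i j : n) :
    scalarMatrix n A T i j = algebraMap ℂ A (T i j) := rfl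

theorem scalarMatrix_injective [Nontrivial A] : Function.Injective (scalarMatrix n A) :=
  fun _ _ h => CStarMatrix.ext fun i j =>
    (algebraMap ℂ A).injective (congrFun (congrFun h i) j)

theorem commute_scalarMatrix_matrixAmplification (T : CStarMatrix n n ℂ) (x : A) :
    Commute (scalarMatrix n A T) (matrixAmplification n A x) := by
  ext i j
  rw [mul_matrixAmplification_apply, scalarMatrix_apply, Algebra.commutes]
  simp [CStarMatrix.mul_apply, matrixAmplification_apply, scalarMatrix_apply]

/-- The connecting map `x ↦ π(x) + (1 - π(1)) (1 ⊗ x)` attached to a finite dimensional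
representation `π`. -/
def connectingMap (π : A →⋆ₙₐ[ℂ] CStarMatrix n n ℂ) : A →⋆ₐ[ℂ] CStarMatrix n n A :=
  splice ((scalarMatrix n A : CStarMatrix n n ℂ →⋆ₙₐ[ℂ] CStarMatrix n n A).comp π)
    (matrixAmplification n A) fun x => commute_scalarMatrix_matrixAmplification (π 1) x

theorem scalarMatrix_mul_connectingMap (π : A →⋆ₙₐ[ℂ] CStarMatrix n n ℂ) (x : A) :
    scalarMatrix n A (π 1) * connectingMap π x = scalarMatrix n A (π x) :=
  map_one_mul_splice
    ((scalarMatrix n A : CStarMatrix n n ℂ →⋆ₙₐ[ℂ] CStarMatrix n n A).comp π) _ _ x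

theorem connectingMap_mul_scalarMatrix (π : A →⋆ₙₐ[ℂ] CStarMatrix n n ℂ) (x : A) :
    connectingMap π x * scalarMatrix n A (π 1) = scalarMatrix n A (π x) :=
  splice_mul_map_one
    ((scalarMatrix n A : CStarMatrix n n ℂ →⋆ₙₐ[ℂ] CStarMatrix n n A).comp π) _ _ x

theorem connectingMap_sub_matrixAmplification (π : A →⋆ₙₐ[ℂ] CStarMatrix n n ℂ) (x : A) :
    connectingMap π x - matrixAmplification n A x =
      (scalarMatrix n A (π x) - matrixAmplification n A x) * scalarMatrix n A (π 1) :=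
  splice_sub _ _ _ x

theorem map_eq_zero_of_connectingMap_eq_zero [Nontrivial A] (π : A →⋆ₙₐ[ℂ] CStarMatrix n n ℂ)
    {x : A} (hx : connectingMap π x = 0) : π x = 0 := by
  refine (map_eq_zero_iff _ (scalarMatrix_injective (A := A))).1 ?_
  rw [← scalarMatrix_mul_connectingMap, hx, mul_zero]

theorem connectingMap_injective [Nontrivial A] (π : A →⋆ₙₐ[ℂ] CStarMatrix n n ℂ) (h : π 1 ≠ 1) :
    Function.Injective (connectingMap π) := by
  refine (injective_iff_map_eq_zero _).2 fun x hx => ?_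
  obtain ⟨i, j, hij⟩ : ∃ i j, (1 - π 1 : CStarMatrix n n ℂ) i j ≠ 0 := by
    by_contra! hzero
    exact h (sub_eq_zero.1 (CStarMatrix.ext hzero)).symm
  have hamp : scalarMatrix n A (1 - π 1) * matrixAmplification n A x = 0 := by
    have hsub := connectingMap_sub_matrixAmplification π x
    rw [hx, map_eq_zero_of_connectingMap_eq_zero π hx, map_zero, zero_sub, neg_mul,
      neg_inj] at hsub
    rw [(commute_scalarMatrix_matrixAmplification _ x).eq, map_sub, map_one, mul_sub, mul_one,
      ← hsub, sub_self]
  have hentry : (1 - π 1 : CStarMatrix n n ℂ) i j • x = 0 := by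
    rw [Algebra.smul_def, ← scalarMatrix_apply, ← mul_matrixAmplification_apply, hamp]
    rfl
  exact (smul_eq_zero.1 hentry).resolve_left hij

end ConnectingMap

/-- A system of matrix units in a star ring. -/
structure IsMatrixUnits {n B : Type*} [Fintype n] [DecidableEq n] [Ring B] [StarRing B]
    (F : n → n → B) : Prop where
  mul_eq : ∀ i j k l, F i j * F k l = if j = k then F i l else 0
  star_eq : ∀ i j, star (F i j) = F j i
  sum_eq : ∑ i, F i i = 1

namespace IsMatrixUnits

variable {n : Type*} [Fintype n] [DecidableEq n] {A B : Type*} [Ring A] [Algebra ℂ A]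
  [Ring B] [StarRing B] [Algebra ℂ B]

theorem sum_map_mul_mul_sum_map_mul {F : n → n → B} (hF : IsMatrixUnits F) (ψ : A →ₐ[ℂ] B)
    (hc : ∀ i j x, Commute (ψ x) (F i j)) (x y : CStarMatrix n n A) :
    (∑ i, ∑ j, ψ (x i j) * F i j) * (∑ i, ∑ j, ψ (y i j) * F i j) =
      ∑ i, ∑ j, ψ ((x * y) i j) * F i j := by
  have hterm : ∀ i j k l, ψ (x i j) * F i j * (ψ (y k l) * F k l)
      = if j = k then ψ (x i j * y k l) * F i l else 0 := by
    intro i j k l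
    rw [mul_assoc, ← mul_assoc (F i j), ← (hc i j (y k l)).eq, mul_assoc, hF.mul_eq, ← mul_assoc,
      ← map_mul, mul_ite, mul_zero]
  simp only [Finset.sum_mul, Finset.mul_sum, hterm, CStarMatrix.mul_apply, map_sum,
    Finset.sum_ite_eq', Finset.mem_univ, if_true]
  rw [Finset.sum_comm, eq_comm, Finset.sum_comm]
  exact Finset.sum_congr rfl fun l _ => Finset.sum_comm

variable [StarRing A]

/-- The representation of `M_n(A)` given by a representation of `A` and a commuting system of
matrix units. -/
def lift {F : n → n → B} (hF : IsMatrixUnits F) (ψ : A →⋆ₐ[ℂ] B)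
    (hc : ∀ i j x, Commute (ψ x) (F i j)) : CStarMatrix n n A →⋆ₐ[ℂ] B where
  toFun x := ∑ i, ∑ j, ψ (x i j) * F i j
  map_one' := by
    simpa [CStarMatrix.one_apply, apply_ite ψ] using hF.sum_eq
  map_mul' x y := (hF.sum_map_mul_mul_sum_map_mul ψ.toAlgHom hc x y).symm
  map_zero' := by simp
  map_add' x y := by simp [add_mul, Finset.sum_add_distrib]
  commutes' r := by
    simp [CStarMatrix.algebraMap_apply, apply_ite ψ, AlgHomClass.commutes ψ, ← Finset.mul_sum,
      hF.sum_eq]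
  map_star' x := by
    simp only [star_sum, star_mul, hF.star_eq, CStarMatrix.star_apply, map_star]
    rw [Finset.sum_comm]
    refine Finset.sum_congr rfl fun i _ => Finset.sum_congr rfl fun j _ => ?_
    rw [← map_star]
    exact (hc j i _).eq

variable {F : n → n → B} (hF : IsMatrixUnits F) (ψ : A →⋆ₐ[ℂ] B)
    (hc : ∀ i j x, Commute (ψ x) (F i j))

theorem lift_apply (x : CStarMatrix n n A) : hF.lift ψ hc x = ∑ i, ∑ j, ψ (x i j) * F i j := rfl

theorem lift_matrixAmplification (x : A) : hF.lift ψ hc (matrixAmplification n A x) = ψ x := by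
  simp [lift_apply, matrixAmplification_apply, apply_ite ψ, ← Finset.mul_sum, hF.sum_eq]

theorem lift_single (a b : n) (x : A) :
    hF.lift ψ hc (CStarMatrix.ofMatrix (Matrix.single a b x)) = ψ x * F a b := by
  rw [lift_apply, Finset.sum_eq_single a, Finset.sum_eq_single b]
  all_goals simp +contextual [Matrix.single_apply, eq_comm]

theorem forall_commute_lift_iff {T : B} : (∀ y, Commute T (hF.lift ψ hc y)) ↔
    (∀ x, Commute T (ψ x)) ∧ ∀ a b, Commute T (F a b) := by
  refine ⟨fun h => ⟨fun x => ?_, fun a b => ?_⟩, fun h y => ?_⟩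
  · exact hF.lift_matrixAmplification ψ hc x ▸ h _
  · simpa only [lift_single, map_one, one_mul] using h (CStarMatrix.ofMatrix (Matrix.single a b 1))
  · exact Commute.sum_right _ _ _ fun a _ => Commute.sum_right _ _ _ fun b _ =>
      (h.1 _).mul_right (h.2 a b)

variable [StarModule ℂ A]

theorem lift_connectingMap_sub (π : A →⋆ₙₐ[ℂ] CStarMatrix n n ℂ) (x : A) :
    hF.lift ψ hc (connectingMap π x) - ψ x
      = (hF.lift ψ hc (scalarMatrix n A (π x)) - ψ x) * hF.lift ψ hc (scalarMatrix n A (π 1)) := by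
  rw [← lift_matrixAmplification hF ψ hc x, ← map_sub, ← map_sub, ← map_mul,
    connectingMap_sub_matrixAmplification]

end IsMatrixUnits

section FiniteDimensional

open Matrix

/-- The `⋆`-homomorphism into a bounded product of C⋆-algebras with given components. -/
noncomputable def lpInftyProd {ι : Type*} {B : ι → Type*} [∀ i, NonUnitalCStarAlgebra (B i)]
    {A : Type*} [NonUnitalCStarAlgebra A] (f : ∀ i, A →⋆ₙₐ[ℂ] B i) : A →⋆ₙₐ[ℂ] lp B ∞ where
  toFun x := ⟨fun i => f i x, memℓp_infty ⟨‖x‖, by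
    rintro _ ⟨i, rfl⟩
    exact NonUnitalStarAlgHom.norm_apply_le (f i) x⟩⟩
  map_smul' c x := by ext i; exact map_smul (f i) c x
  map_zero' := by ext i; exact map_zero (f i)
  map_add' x y := by ext i; exact map_add (f i) x y
  map_mul' x y := by ext i; exact map_mul (f i) x y
  map_star' x := by ext i; exact map_star (f i) x

theorem exists_lt_norm_of_separating {ι A : Type*} {B : ι → Type*}
    [∀ i, NonUnitalCStarAlgebra (B i)] [NonUnitalCStarAlgebra A] (f : ∀ i, A →⋆ₙₐ[ℂ] B i)
    (hf : ∀ x, x ≠ 0 → ∃ i, f i x ≠ 0) {x : A} {c : ℝ} (hc : 0 ≤ c) (hx : c < ‖x‖) :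
    ∃ i, c < ‖f i x‖ := by
  by_contra! hle
  have hinj : Function.Injective (lpInftyProd f) := by
    refine (injective_iff_map_eq_zero _).2 fun y hy => ?_
    by_contra hne
    obtain ⟨i, hi⟩ := hf y hne
    exact hi (congrArg (fun z : lp B ∞ => z i) hy)
  rw [← NonUnitalStarAlgHom.norm_map (lpInftyProd f) hinj] at hx
  exact hx.not_ge (lp.norm_le_of_forall_le hc hle)

/-- The `⋆`-homomorphism `M ↦ V M V*` between matrix algebras given by an isometry `V`. -/
def conjByIsometry {m n : Type*} [Fintype m] [Fintype n] [DecidableEq n] (V : Matrix m n ℂ)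
    (hV : Vᴴ * V = 1) : CStarMatrix n n ℂ →⋆ₙₐ[ℂ] CStarMatrix m m ℂ where
  toFun M := CStarMatrix.ofMatrix (V * CStarMatrix.ofMatrix.symm M * Vᴴ)
  map_smul' c M := show V * (c • CStarMatrix.ofMatrix.symm M) * Vᴴ = _ by
    rw [Matrix.mul_smul, Matrix.smul_mul]; rfl
  map_zero' := show V * (0 : Matrix n n ℂ) * Vᴴ = 0 by simp
  map_add' M N := show V * (CStarMatrix.ofMatrix.symm M + CStarMatrix.ofMatrix.symm N) * Vᴴ = _ by
    rw [Matrix.mul_add, Matrix.add_mul]; rfl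
  map_mul' M N := show V * (CStarMatrix.ofMatrix.symm M * CStarMatrix.ofMatrix.symm N) * Vᴴ =
      V * CStarMatrix.ofMatrix.symm M * Vᴴ * (V * CStarMatrix.ofMatrix.symm N * Vᴴ) by
    simp only [Matrix.mul_assoc]
    rw [← Matrix.mul_assoc Vᴴ V, hV, Matrix.one_mul]
  map_star' M := show V * (CStarMatrix.ofMatrix.symm M)ᴴ * Vᴴ =
      (V * CStarMatrix.ofMatrix.symm M * Vᴴ)ᴴ by
    simp only [conjTranspose_mul, conjTranspose_conjTranspose, Matrix.mul_assoc]

theorem conjByIsometry_injective {m n : Type*} [Fintype m] [Fintype n] [DecidableEq n]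
    (V : Matrix m n ℂ) (hV : Vᴴ * V = 1) : Function.Injective (conjByIsometry V hV) := by
  refine Function.LeftInverse.injective (g := fun N : Matrix m m ℂ => Vᴴ * N * V) fun M => ?_
  change Vᴴ * (V * CStarMatrix.ofMatrix.symm M * Vᴴ) * V = CStarMatrix.ofMatrix.symm M
  simp only [Matrix.mul_assoc]
  rw [hV, Matrix.mul_one, ← Matrix.mul_assoc, hV, Matrix.one_mul]

theorem sum_conjByIsometry_diag {m n : Type*} [Fintype m] [Fintype n] [DecidableEq n]
    (V : Matrix m n ℂ) (hV : Vᴴ * V = 1) (M : CStarMatrix n n ℂ) :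
    ∑ i, conjByIsometry V hV M i i = ∑ i, M i i := by
  change (V * CStarMatrix.ofMatrix.symm M * Vᴴ).trace = (CStarMatrix.ofMatrix.symm M).trace
  rw [Matrix.trace_mul_comm, ← Matrix.mul_assoc, hV, Matrix.one_mul]

theorem exists_injective_hom_of_embedding {m n : Type*} [Fintype m] [Fintype n] (f : n ↪ m) :
    ∃ φ : CStarMatrix n n ℂ →⋆ₙₐ[ℂ] CStarMatrix m m ℂ, Function.Injective φ ∧
      ∀ M, ∑ i, φ M i i = ∑ i, M i i := by
  classical
  have hV : ((1 : Matrix m m ℂ).submatrix id f)ᴴ * (1 : Matrix m m ℂ).submatrix id f = 1 := by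
    rw [conjTranspose_submatrix, conjTranspose_one, ← submatrix_mul _ _ _ _ _ Function.bijective_id,
      Matrix.one_mul, submatrix_one f f.injective]
  exact ⟨conjByIsometry _ hV, conjByIsometry_injective _ hV, sum_conjByIsometry_diag _ hV⟩

/-- The `⋆`-homomorphism into a full product of algebras with given components. -/
def piHom {ι A : Type*} {B : ι → Type*} [NonUnitalNonAssocSemiring A] [DistribMulAction ℂ A]
    [Star A] [∀ i, NonUnitalNonAssocSemiring (B i)] [∀ i, DistribMulAction ℂ (B i)]
    [∀ i, Star (B i)] (f : ∀ i, A →⋆ₙₐ[ℂ] B i) : A →⋆ₙₐ[ℂ] ∀ i, B i where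
  toFun x i := f i x
  map_smul' c x := funext fun i => map_smul (f i) c x
  map_zero' := funext fun i => map_zero (f i)
  map_add' x y := funext fun i => map_add (f i) x y
  map_mul' x y := funext fun i => map_mul (f i) x y
  map_star' x := funext fun i => map_star (f i) x

/-- The block diagonal representation of a finite product of matrix algebras. -/
def blockDiagonalHom {ι : Type*} [Fintype ι] [DecidableEq ι] (d : ι → Type*) [∀ i, Fintype (d i)] :
    (∀ i, CStarMatrix (d i) (d i) ℂ) →⋆ₙₐ[ℂ] CStarMatrix (Σ i, d i) (Σ i, d i) ℂ where
  toFun M := CStarMatrix.ofMatrix (blockDiagonal' fun i => CStarMatrix.ofMatrix.symm (M i))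
  map_smul' c M := blockDiagonal'_smul c fun i => CStarMatrix.ofMatrix.symm (M i)
  map_zero' := blockDiagonal'_zero
  map_add' M N := blockDiagonal'_add (fun i => CStarMatrix.ofMatrix.symm (M i))
    fun i => CStarMatrix.ofMatrix.symm (N i)
  map_mul' M N := blockDiagonal'_mul (fun i => CStarMatrix.ofMatrix.symm (M i))
    fun i => CStarMatrix.ofMatrix.symm (N i)
  map_star' M := (blockDiagonal'_conjTranspose fun i => CStarMatrix.ofMatrix.symm (M i)).symm

theorem blockDiagonalHom_injective {ι : Type*} [Fintype ι] [DecidableEq ι] (d : ι → Type*)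
    [∀ i, Fintype (d i)] : Function.Injective (blockDiagonalHom d) :=
  blockDiagonal'_injective

/-- The identification of matrices with matrix entries and matrices over a product. -/
def compStarAlgEquiv (m n : Type*) [Fintype m] [Fintype n] [DecidableEq m] [DecidableEq n] :
    CStarMatrix m m (CStarMatrix n n ℂ) ≃⋆ₐ[ℂ] CStarMatrix (m × n) (m × n) ℂ where
  __ := Matrix.compAlgEquiv m n ℂ ℂ
  map_smul' _ _ := rfl
  map_star' _ := rfl

open scoped MatrixOrder in
theorem re_sum_diag_le_card {n : Type*} [Fintype n] {p : CStarMatrix n n ℂ}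
    (hp : IsStarProjection p) : (∑ i, p i i).re ≤ Fintype.card n := by
  classical
  have hq : IsStarProjection (CStarMatrix.ofMatrixStarAlgEquiv.symm p) :=
    hp.map CStarMatrix.ofMatrixStarAlgEquiv.symm
  have htrace := (nonneg_iff_posSemidef.1 hq.one_sub.nonneg).trace_nonneg
  rw [trace_sub, trace_one, sub_nonneg] at htrace
  exact (Complex.le_def.1 htrace).1

end FiniteDimensional

namespace IsResiduallyFiniteDimensional

variable {A : Type u} [CStarAlgebra A]

theorem exists_lt_norm (hA : IsResiduallyFiniteDimensional A) {x : A} {c : ℝ} (hc : 0 ≤ c)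
    (hx : c < ‖x‖) :
    ∃ (n : ℕ) (π : A →⋆ₙₐ[ℂ] CStarMatrix (Fin n) (Fin n) ℂ), c < ‖π x‖ := by
  obtain ⟨⟨n, π⟩, hπ⟩ := exists_lt_norm_of_separating
    (ι := Σ n : ℕ, (A →⋆ₙₐ[ℂ] CStarMatrix (Fin n) (Fin n) ℂ)) (fun i => i.2) (fun y hy => by
      obtain ⟨n, π, hπ⟩ := hA y hy
      let e := CStarMatrix.ofMatrixStarAlgEquiv (n := Fin n) (A := ℂ)
      exact ⟨⟨n, e.toNonUnitalStarAlgHom.comp π⟩, hπ⟩) hc hx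
  exact ⟨n, π, hπ⟩

theorem exists_norm_le_two_mul (hA : IsResiduallyFiniteDimensional A) (F : Finset A) :
    ∃ (k : ℕ) (π : A →⋆ₙₐ[ℂ] CStarMatrix (Fin k) (Fin k) ℂ), ∀ x ∈ F, ‖x‖ ≤ 2 * ‖π x‖ := by
  classical
  have hsingle : ∀ x : A, ∃ (n : ℕ) (π : A →⋆ₙₐ[ℂ] CStarMatrix (Fin n) (Fin n) ℂ),
      ‖x‖ ≤ 2 * ‖π x‖ := by
    intro x
    rcases eq_or_ne x 0 with rfl | hx
    · exact ⟨0, 0, by simp⟩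
    · obtain ⟨n, π, hπ⟩ := hA.exists_lt_norm (half_pos (norm_pos_iff.2 hx)).le
        (half_lt_self (norm_pos_iff.2 hx))
      exact ⟨n, π, by linarith⟩
  choose d π hπ using hsingle
  obtain ⟨φ, hφ, -⟩ := exists_injective_hom_of_embedding
    (Fintype.equivFin (Σ x : F, Fin (d x))).toEmbedding
  let ψ := φ.comp (blockDiagonalHom fun x : F => Fin (d x))
  have hψ : Function.Injective ψ := hφ.comp (blockDiagonalHom_injective _)
  refine ⟨_, ψ.comp (piHom fun x : F => π x), fun x hx => (hπ x).trans ?_⟩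
  rw [NonUnitalStarAlgHom.comp_apply, NonUnitalStarAlgHom.norm_map ψ hψ]
  gcongr
  exact norm_le_pi_norm (piHom (fun x : F => π x) x) ⟨x, hx⟩

theorem exists_representation [Nontrivial A] (hA : IsResiduallyFiniteDimensional A) (F : Finset A)
    {δ : ℝ} (hδ : 0 < δ) :
    ∃ (l : ℕ) (π : A →⋆ₙₐ[ℂ] CStarMatrix (Fin (2 ^ l)) (Fin (2 ^ l)) ℂ), 0 < l ∧ π 1 ≠ 0 ∧
      (∑ i, π 1 i i).re ≤ δ * 2 ^ l ∧ ∀ x ∈ F, ‖x‖ ≤ 2 * ‖π x‖ := by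
  classical
  obtain ⟨k, ρ, hρ⟩ := hA.exists_norm_le_two_mul (insert 1 F)
  obtain ⟨l, hl⟩ := pow_unbounded_of_one_lt (max 1 (max (k : ℝ) (k / δ))) (one_lt_two (α := ℝ))
  simp only [max_lt_iff, div_lt_iff₀ hδ] at hl
  obtain ⟨hl_one, hl_card, hl_trace⟩ := hl
  obtain ⟨φ, hφ, hφ_trace⟩ := exists_injective_hom_of_embedding
    (Fin.castLEEmb (n := k) (m := 2 ^ l) (by exact_mod_cast hl_card.le))
  have hnorm : ∀ x ∈ insert 1 F, ‖x‖ ≤ 2 * ‖φ.comp ρ x‖ := fun x hx => by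
    simpa only [NonUnitalStarAlgHom.comp_apply, NonUnitalStarAlgHom.norm_map φ hφ] using hρ x hx
  refine ⟨l, φ.comp ρ, ?_, fun hzero => ?_, ?_, fun x hx => hnorm x (Finset.mem_insert_of_mem hx)⟩
  · rcases l.eq_zero_or_pos with rfl | hpos
    · simp at hl_one
    · exact hpos
  · have hone := hnorm 1 (Finset.mem_insert_self 1 F)
    rw [hzero, norm_zero, mul_zero] at hone
    exact one_ne_zero (norm_le_zero_iff.1 hone)
  · have hcard := re_sum_diag_le_card ((IsStarProjection.one (R := A)).map ρ)
    rw [Fintype.card_fin] at hcard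
    rw [NonUnitalStarAlgHom.comp_apply, hφ_trace]
    linarith

theorem cstarMatrix [PartialOrder A] [StarOrderedRing A] (hA : IsResiduallyFiniteDimensional A)
    (n : ℕ) : IsResiduallyFiniteDimensional (CStarMatrix (Fin n) (Fin n) A) := by
  intro x hx
  obtain ⟨i, j, hij⟩ : ∃ i j, x i j ≠ 0 := by
    by_contra! hzero
    exact hx (CStarMatrix.ext hzero)
  obtain ⟨k, π, hπ⟩ := hA _ hij
  let π' := CStarMatrix.ofMatrixStarAlgEquiv.toNonUnitalStarAlgHom.comp π
  let e := ((compStarAlgEquiv (Fin n) (Fin k)).trans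
    (CStarMatrix.reindexₐ ℂ ℂ finProdFinEquiv)).trans CStarMatrix.ofMatrixStarAlgEquiv.symm
  refine ⟨n * k, e.toNonUnitalStarAlgHom.comp (CStarMatrix.mapₙₐ π'), fun hzero => hπ ?_⟩
  have hmap : CStarMatrix.mapₙₐ π' x = 0 := e.injective (hzero.trans (map_zero e).symm)
  exact congrFun (congrFun hmap i) j

end IsResiduallyFiniteDimensional

section Tower

/-- A residually finite dimensional C⋆-algebra together with an exhaustion by finite sets, carried
along the recursive construction of a `Tower`. -/
structure Stage where
  carrier : Type u
  [inst : CStarAlgebra carrier]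
  [nontrivial : Nontrivial carrier]
  [separable : TopologicalSpace.SeparableSpace carrier]
  rfd : IsResiduallyFiniteDimensional carrier
  G : ℕ → Finset carrier
  mono : Monotone G
  dense : Dense (⋃ k, (G k : Set carrier))

attribute [instance] Stage.inst Stage.nontrivial Stage.separable

theorem exists_monotone_dense_finsets (X : Type*) [TopologicalSpace X] [Nonempty X]
    [TopologicalSpace.SeparableSpace X] :
    ∃ G : ℕ → Finset X, Monotone G ∧ Dense (⋃ k, (G k : Set X)) := by
  classical
  refine ⟨fun k => (Finset.range k).image (TopologicalSpace.denseSeq X),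
    fun a b h => Finset.image_subset_image (Finset.range_mono h), ?_⟩
  refine (TopologicalSpace.denseRange_denseSeq X).mono ?_
  rintro _ ⟨n, rfl⟩
  exact Set.mem_iUnion.2 ⟨n + 1, Finset.mem_image_of_mem _ (Finset.self_mem_range_succ n)⟩

namespace Stage

theorem exists_rep (S : Stage) (m : ℕ) :
    ∃ (l : ℕ) (π : S.carrier →⋆ₙₐ[ℂ] CStarMatrix (Fin (2 ^ l)) (Fin (2 ^ l)) ℂ), 0 < l ∧ π 1 ≠ 0 ∧
      (∑ i, π 1 i i).re ≤ (1 / 4) ^ (m + 1) * 2 ^ l ∧ ∀ x ∈ S.G m, ‖x‖ ≤ 2 * ‖π x‖ :=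
  S.rfd.exists_representation (S.G m) (by positivity)

/-- The exponent `l` of the matrix size `2 ^ l` used at step `m` of the tower. -/
noncomputable def size (S : Stage) (m : ℕ) : ℕ := (S.exists_rep m).choose

/-- The finite dimensional representation used at step `m` of the tower. -/
noncomputable def rep (S : Stage) (m : ℕ) :
    S.carrier →⋆ₙₐ[ℂ] CStarMatrix (Fin (2 ^ S.size m)) (Fin (2 ^ S.size m)) ℂ :=
  (S.exists_rep m).choose_spec.choose

theorem rep_spec (S : Stage) (m : ℕ) : 0 < S.size m ∧ S.rep m 1 ≠ 0 ∧
    (∑ i, S.rep m 1 i i).re ≤ (1 / 4) ^ (m + 1) * 2 ^ S.size m ∧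
      ∀ x ∈ S.G m, ‖x‖ ≤ 2 * ‖S.rep m x‖ :=
  (S.exists_rep m).choose_spec.choose_spec

/-- The next stage of the tower: the `2 ^ l × 2 ^ l` matrices over the present one. Its finite sets
contain the images of the present ones under the connecting map. -/
noncomputable def next (S : Stage) (m : ℕ) : Stage :=
  letI := CStarAlgebra.spectralOrder S.carrier
  letI := CStarAlgebra.spectralOrderedRing S.carrier
  let B := CStarMatrix (Fin (2 ^ S.size m)) (Fin (2 ^ S.size m)) S.carrier
  letI : DecidableEq B := Classical.decEq B
  haveI : TopologicalSpace.SeparableSpace B := inferInstanceAs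
    (TopologicalSpace.SeparableSpace (Fin (2 ^ S.size m) → Fin (2 ^ S.size m) → S.carrier))
  have hG := exists_monotone_dense_finsets B
  { carrier := B
    rfd := S.rfd.cstarMatrix _
    G := fun k => (S.G k).image (connectingMap (S.rep m)) ∪ hG.choose k
    mono := fun a b h => Finset.union_subset_union (Finset.image_subset_image (S.mono h))
      (hG.choose_spec.1 h)
    dense := hG.choose_spec.2.mono (Set.iUnion_mono fun k => by simp) }

/-- The identity map, with the algebra operations of `S.next m` unfolded. -/
noncomputable def nextEquiv (S : Stage) (m : ℕ) : (S.next m).carrier ≃⋆ₐ[ℂ]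
    CStarMatrix (Fin (2 ^ S.size m)) (Fin (2 ^ S.size m)) S.carrier :=
  letI := CStarAlgebra.spectralOrder S.carrier
  letI := CStarAlgebra.spectralOrderedRing S.carrier
  StarAlgEquiv.refl (R := ℂ) (A := CStarMatrix (Fin (2 ^ S.size m)) (Fin (2 ^ S.size m)) S.carrier)

theorem connectingMap_mem_next (S : Stage) (m k : ℕ) {x : S.carrier} (hx : x ∈ S.G k) :
    (S.nextEquiv m).symm (connectingMap (S.rep m) x) ∈ (S.next m).G k :=
  letI : DecidableEq (S.next m).carrier := Classical.decEq _
  Finset.mem_union_left _ (Finset.mem_image_of_mem _ hx)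

end Stage

/-- An inductive sequence of matrix algebras over a given C⋆-algebra, each connected to the next
by means of a finite dimensional representation. The representation `rep m` at most halves norms on
the finite set `G m m`, and these sets exhaust the inductive limit. -/
structure Tower (E : Type u) [CStarAlgebra E] where
  A : ℕ → Type u
  [inst : ∀ m, CStarAlgebra (A m)]
  [nontrivial : ∀ m, Nontrivial (A m)]
  [separable : ∀ m, TopologicalSpace.SeparableSpace (A m)]
  base : E ≃⋆ₐ[ℂ] A 0
  l : ℕ → ℕ
  l_pos : ∀ m, 0 < l m
  rep : ∀ m, A m →⋆ₙₐ[ℂ] CStarMatrix (Fin (2 ^ l m)) (Fin (2 ^ l m)) ℂ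
  rep_one : ∀ m, rep m 1 ≠ 0
  trace_le : ∀ m, (∑ i, rep m 1 i i).re ≤ (1 / 4) ^ (m + 1) * 2 ^ l m
  iso : ∀ m, A (m + 1) ≃⋆ₐ[ℂ] CStarMatrix (Fin (2 ^ l m)) (Fin (2 ^ l m)) (A m)
  G : ∀ m, ℕ → Finset (A m)
  mono : ∀ m, Monotone (G m)
  dense : ∀ m, Dense (⋃ k, (G m k : Set (A m)))
  connectingMap_mem : ∀ m k x, x ∈ G m k →
    (iso m).symm (connectingMap (rep m) x) ∈ G (m + 1) k
  norm_le : ∀ m, ∀ x ∈ G m m, ‖x‖ ≤ 2 * ‖rep m x‖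

attribute [instance] Tower.inst Tower.nontrivial Tower.separable

theorem IsResiduallyFiniteDimensional.nonempty_tower {E : Type u} [CStarAlgebra E] [Nontrivial E]
    [TopologicalSpace.SeparableSpace E] (hE : IsResiduallyFiniteDimensional E) :
    Nonempty (Tower E) := by
  obtain ⟨G, hmono, hdense⟩ := exists_monotone_dense_finsets E
  let S (n : ℕ) : Stage :=
    Nat.rec { carrier := E, rfd := hE, G := G, mono := hmono, dense := hdense }
      (fun m T => T.next m) n
  exact ⟨{
    A := fun m => (S m).carrier
    inst := fun m => (S m).inst
    nontrivial := fun m => (S m).nontrivial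
    separable := fun m => (S m).separable
    base := StarAlgEquiv.refl ℂ E
    l := fun m => (S m).size m
    l_pos := fun m => ((S m).rep_spec m).1
    rep := fun m => (S m).rep m
    rep_one := fun m => ((S m).rep_spec m).2.1
    trace_le := fun m => ((S m).rep_spec m).2.2.1
    iso := fun m => (S m).nextEquiv m
    G := fun m => (S m).G
    mono := fun m => (S m).mono
    dense := fun m => (S m).dense
    connectingMap_mem := fun m k _ hx => (S m).connectingMap_mem_next m k hx
    norm_le := fun m => ((S m).rep_spec m).2.2.2 }⟩

theorem ClosedUnderIncreasingUnions.of_equiv {C : ∀ (B : Type u) [CStarAlgebra B], Prop}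
    (hC : ClosedUnderIncreasingUnions C) {A B : Type u} [CStarAlgebra A] [CStarAlgebra B]
    (e : A ≃⋆ₐ[ℂ] B) (hA : C A) : C B := by
  have hrange : Set.range (e : A →⋆ₐ[ℂ] B) = Set.univ := e.surjective.range_eq
  exact hC (fun _ => A) B (fun _ => e) (fun _ => e.injective) (fun _ => subset_rfl)
    (by rw [hrange, Set.iUnion_const]; exact dense_univ) fun _ => hA

theorem Tower.mem_class {C : ∀ (B : Type u) [CStarAlgebra B], Prop}
    (hC : ClosedUnderIncreasingUnions C) (hC' : ClosedUnderMatrixTensoring C) {E : Type u}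
    [CStarAlgebra E] (T : Tower E) (hE : C E) (m : ℕ) : C (T.A m) := by
  induction m with
  | zero => exact hC.of_equiv T.base hE
  | succ m ih =>
    let _ := CStarAlgebra.spectralOrder (T.A m)
    let _ := CStarAlgebra.spectralOrderedRing (T.A m)
    exact hC.of_equiv (T.iso m).symm (hC' (T.A m) (2 ^ T.l m) Nat.one_le_two_pow ih)

end Tower

section StrongLimits

variable {ι H : Type*} [NormedAddCommGroup H]

theorem equicontinuous_of_opNorm_le [NormedSpace ℂ H] {u : ι → H →L[ℂ] H} {C : ℝ}
    (hu : ∀ n, ‖u n‖ ≤ C) : Equicontinuous fun n => ⇑(u n) :=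
  ((NormedSpace.equicontinuous_TFAE u).out 5 1).1 (Exists.intro C hu)

theorem tendsto_apply_of_dense [NormedSpace ℂ H] {l : Filter ι} {u : ι → H →L[ℂ] H}
    {T : H →L[ℂ] H} {C : ℝ} (hu : ∀ n, ‖u n‖ ≤ C) {D : Set H} (hD : Dense D)
    (h : ∀ f ∈ D, Tendsto (fun n => u n f) l (𝓝 (T f))) (f : H) :
    Tendsto (fun n => u n f) l (𝓝 (T f)) :=
  (equicontinuous_of_opNorm_le hu f).tendsto_of_mem_closure
    (T.continuous.continuousAt.mono_left inf_le_left) h (hD f)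

theorem exists_tendsto_apply_of_dense [NormedSpace ℂ H] [CompleteSpace H] {u : ℕ → H →L[ℂ] H}
    {C : ℝ} (hu : ∀ n, ‖u n‖ ≤ C) {D : Set H} (hD : Dense D)
    (h : ∀ f ∈ D, CauchySeq fun n => u n f) :
    ∃ T : H →L[ℂ] H, ∀ f, Tendsto (fun n => u n f) atTop (𝓝 (T f)) := by
  have hcauchy (f : H) : CauchySeq fun n => u n f := by
    rw [Metric.cauchySeq_iff']
    intro ε hε
    have hequi := Metric.equicontinuousAt_iff.1 (equicontinuous_of_opNorm_le hu f) (ε / 3)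
      (by positivity)
    obtain ⟨δ, hδ, hclose⟩ := hequi
    obtain ⟨g, hg, hfg⟩ := hD.exists_dist_lt f hδ
    obtain ⟨N, hN⟩ := Metric.cauchySeq_iff'.1 (h g hg) (ε / 3) (by positivity)
    refine ⟨N, fun n hn => ?_⟩
    have hfg_at (k : ℕ) : dist (u k f) (u k g) < ε / 3 := hclose g (dist_comm f g ▸ hfg) k
    calc dist (u n f) (u N f)
        ≤ dist (u n f) (u n g) + dist (u n g) (u N g) + dist (u N g) (u N f) :=
          dist_triangle4 _ _ _ _
      _ < ε / 3 + ε / 3 + ε / 3 := by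
          rw [dist_comm (u N g)]
          linarith [hfg_at n, hfg_at N, hN n hn]
      _ = ε := by ring
  choose L hL using fun f => cauchySeq_tendsto_of_complete (hcauchy f)
  exact ⟨continuousLinearMapOfTendsto u (tendsto_pi_nhds.2 hL), hL⟩

/-- The pointwise strong limit `L` of representations `ρ k`. No uniform bound is needed: `L x * L y`
is recovered from the strong limits of `ρ k (star x)` and `ρ k y` by pairing vectors. -/
def strongLimit [InnerProductSpace ℂ H] [CompleteSpace H] {A : Type*} [Semiring A] [Algebra ℂ A]
    [StarRing A] {l : Filter ι} [l.NeBot] (ρ : ι → A →⋆ₐ[ℂ] (H →L[ℂ] H)) (L : A → H →L[ℂ] H)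
    (hL : ∀ x f, Tendsto (fun k => ρ k x f) l (𝓝 (L x f))) : A →⋆ₐ[ℂ] (H →L[ℂ] H) :=
  have commutes (r : ℂ) : L (algebraMap ℂ A r) = algebraMap ℂ _ r := by
    ext f
    refine tendsto_nhds_unique (hL _ f) ?_
    simp only [AlgHomClass.commutes]
    exact tendsto_const_nhds
  have inner_star (x : A) (f g : H) : inner ℂ (L (star x) f) g = inner ℂ f (L x g) :=
    tendsto_nhds_unique ((hL (star x) f).inner tendsto_const_nhds)
      ((tendsto_const_nhds.inner (hL x g)).congr fun k => by
        rw [map_star, ContinuousLinearMap.star_eq_adjoint,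
          ContinuousLinearMap.adjoint_inner_left])
  { toFun := L
    map_one' := by simpa using commutes 1
    map_zero' := by simpa using commutes 0
    commutes' := commutes
    map_add' x y := by
      ext f
      exact tendsto_nhds_unique (hL _ f) (by simpa using (hL x f).add (hL y f))
    map_mul' x y := by
      refine ContinuousLinearMap.ext fun f => ext_inner_left ℂ fun g => ?_
      have hpair : inner ℂ g (L (x * y) f) = inner ℂ (L (star x) g) (L y f) :=
        tendsto_nhds_unique (tendsto_const_nhds.inner (hL (x * y) f))
          (((hL (star x) g).inner (hL y f)).congr fun k => by
            rw [map_star, ContinuousLinearMap.star_eq_adjoint,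
              ContinuousLinearMap.adjoint_inner_left, map_mul, mul_apply_eq_comp])
      rw [hpair, inner_star, mul_apply_eq_comp]
    map_star' x := by
      refine ContinuousLinearMap.ext fun f => ext_inner_right ℂ fun g => ?_
      rw [inner_star, ContinuousLinearMap.star_eq_adjoint,
        ContinuousLinearMap.adjoint_inner_left] }

theorem commute_of_tendsto_apply [NormedSpace ℂ H] {l : Filter ι} [l.NeBot] {u : ι → H →L[ℂ] H}
    {S T : H →L[ℂ] H} (hT : ∀ f, Tendsto (fun n => u n f) l (𝓝 (T f)))
    (h : ∀ n, Commute S (u n)) : Commute S T := by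
  ext f
  exact tendsto_nhds_unique ((S.continuous.tendsto _).comp (hT f))
    ((hT (S f)).congr fun n => (DFunLike.congr_fun (h n).eq f).symm)

end StrongLimits

section CyclicVectors

variable {H : Type*} [NormedAddCommGroup H] [InnerProductSpace ℂ H]

theorem apply_mem_of_commute_starProjection {K : Submodule ℂ H} [K.HasOrthogonalProjection]
    {T : H →L[ℂ] H} (h : Commute K.starProjection T) {f : H} (hf : f ∈ K) : T f ∈ K := by
  have hTf := DFunLike.congr_fun h.eq f
  rw [mul_apply_eq_comp, mul_apply_eq_comp, Submodule.starProjection_eq_self_iff.2 hf] at hTf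
  exact Submodule.starProjection_eq_self_iff.1 hTf

/-- The vector `Ω` is cyclic for the set of operators `S`: no proper closed subspace invariant under
`S` contains `Ω`. -/
def IsCyclicVector (S : Set (H →L[ℂ] H)) (Ω : H) : Prop :=
  ∀ K : Submodule ℂ H, IsClosed (K : Set H) → Ω ∈ K → (∀ T ∈ S, ∀ f ∈ K, T f ∈ K) → K = ⊤

variable [CompleteSpace H]

theorem commute_starProjection {K : Submodule ℂ H} [K.HasOrthogonalProjection] {T : H →L[ℂ] H}
    (hT : ∀ f ∈ K, T f ∈ K) (hT_star : ∀ f ∈ K, star T f ∈ K) : Commute K.starProjection T := by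
  refine (ContinuousLinearMap.IsIdempotentElem.commute_iff
    isStarProjection_starProjection.isIdempotentElem).2 ⟨?_, ?_⟩
  · rwa [Submodule.range_starProjection]
  · rw [Submodule.ker_starProjection]
    exact ContinuousLinearMap.orthogonal_mem_invtSubmodule hT_star

namespace IsCyclicVector

variable {S S' : Set (H →L[ℂ] H)} {Ω : H}

theorem of_centralizer_subset (hΩ : IsCyclicVector S Ω) (hS' : ∀ T ∈ S', star T ∈ S')
    (h : S'.centralizer ⊆ S.centralizer) : IsCyclicVector S' Ω := by
  intro K hK hmem hinv
  have : CompleteSpace K := hK.completeSpace_coe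
  refine hΩ K hK hmem fun T hT f hf => ?_
  have hK_mem : K.starProjection ∈ S'.centralizer := fun W hW =>
    (commute_starProjection (hinv W hW) (hinv _ (hS' W hW))).symm.eq
  exact apply_mem_of_commute_starProjection (Commute.symm (h hK_mem T hT)) hf

theorem denseRange_apply {A : Type*} [Semiring A] [Algebra ℂ A] [StarRing A]
    {ρ : A →⋆ₐ[ℂ] (H →L[ℂ] H)} (hΩ : IsCyclicVector (Set.range ρ) Ω) :
    DenseRange fun x => ρ x Ω := by
  let orbit : A →ₗ[ℂ] H :=
    (ContinuousLinearMap.apply ℂ H Ω).toLinearMap ∘ₗ ρ.toAlgHom.toLinearMap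
  have htop : orbit.range.topologicalClosure = ⊤ := by
    refine hΩ _ orbit.range.isClosed_topologicalClosure (subset_closure ⟨1, ?_⟩) ?_
    · change ρ 1 Ω = Ω
      rw [map_one, one_apply_eq_self]
    · rintro _ ⟨x, rfl⟩ f hf
      refine map_mem_closure (ρ x).continuous hf ?_
      rintro _ ⟨y, rfl⟩
      exact ⟨x * y, DFunLike.congr_fun (map_mul ρ x y) Ω⟩
  exact (Submodule.dense_iff_topologicalClosure_eq_top (s := orbit.range)).2 htop

end IsCyclicVector

end CyclicVectors

section InductiveSequences

variable {A : ℕ → Type*} [∀ m, CStarAlgebra (A m)] (φ : ∀ m, A m →⋆ₐ[ℂ] A (m + 1))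

/-- The composition `A m → A n` of the connecting maps of an inductive sequence. -/
noncomputable def iterHom {m n : ℕ} (h : m ≤ n) : A m →⋆ₐ[ℂ] A n :=
  Nat.leRec (motive := fun n _ => A m →⋆ₐ[ℂ] A n) (StarAlgHom.id ℂ (A m))
    (fun k _ f => (φ k).comp f) h

theorem iterHom_self (m : ℕ) (x : A m) : iterHom φ le_rfl x = x := by
  rw [iterHom, Nat.leRec_self]; rfl

theorem iterHom_succ {m n : ℕ} (h : m ≤ n) (x : A m) :
    iterHom φ (Nat.le_succ_of_le h) x = φ n (iterHom φ h x) := by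
  rw [iterHom, Nat.leRec_succ]; rfl

theorem iterHom_succ_left {m n : ℕ} (h : m + 1 ≤ n) (x : A m) :
    iterHom φ h (φ m x) = iterHom φ (Nat.le_of_succ_le h) x := by
  induction n, h using Nat.le_induction with
  | base => rw [iterHom_self, iterHom_succ φ le_rfl, iterHom_self]
  | succ n h ih => rw [iterHom_succ φ h, ih, iterHom_succ φ (Nat.le_of_succ_le h)]

theorem map_iterHom {B : Type*} {F : ∀ m, A m → B} (hF : ∀ m x, F (m + 1) (φ m x) = F m x)
    {m n : ℕ} (h : m ≤ n) (x : A m) : F n (iterHom φ h x) = F m x := by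
  induction n, h using Nat.le_induction with
  | base => rw [iterHom_self]
  | succ n h ih => rw [iterHom_succ φ h, hF, ih]

theorem norm_iterHom_le {m n : ℕ} (h : m ≤ n) (x : A m) : ‖iterHom φ h x‖ ≤ ‖x‖ :=
  NonUnitalStarAlgHom.norm_apply_le (iterHom φ h) x

/-- A sequence of representations `ψ m` on one Hilbert space which is asymptotically compatible
with the connecting maps in the strong operator topology: the error at stage `m` on a vector `f` is
at most `w f m`, relative to the norm, and these errors are summable for `f` in a dense set `D`. -/
structure AsymptoticRep (H : Type*) [NormedAddCommGroup H] [InnerProductSpace ℂ H]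
    [CompleteSpace H] where
  ψ : ∀ m, A m →⋆ₐ[ℂ] (H →L[ℂ] H)
  w : H → ℕ → ℝ
  w_nonneg : ∀ f m, 0 ≤ w f m
  D : Set H
  dense : Dense D
  summable : ∀ f ∈ D, Summable (w f)
  step_le : ∀ m (x : A m) f, ‖ψ (m + 1) (φ m x) f - ψ m x f‖ ≤ ‖x‖ * w f m

namespace AsymptoticRep

variable {φ} {H : Type*} [NormedAddCommGroup H] [InnerProductSpace ℂ H] [CompleteSpace H]
  (R : AsymptoticRep φ H)

/-- The representation of `A m` obtained by passing to the stage `m + k`. -/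
noncomputable def approx (m k : ℕ) : A m →⋆ₐ[ℂ] (H →L[ℂ] H) :=
  (R.ψ (m + k)).comp (iterHom φ (Nat.le_add_right m k))

theorem norm_approx_le (m k : ℕ) (x : A m) : ‖R.approx m k x‖ ≤ ‖x‖ :=
  NonUnitalStarAlgHom.norm_apply_le (R.approx m k) x

theorem approx_zero (m : ℕ) (x : A m) : R.approx m 0 x = R.ψ m x :=
  congrArg (R.ψ m) (iterHom_self φ m x)

theorem approx_succ (m k : ℕ) (x : A m) :
    R.approx m (k + 1) x = R.ψ (m + k + 1) (φ (m + k) (iterHom φ (Nat.le_add_right m k) x)) :=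
  congrArg (R.ψ (m + k + 1)) (iterHom_succ φ (Nat.le_add_right m k) x)

theorem approx_step (m k : ℕ) (x : A m) : R.approx (m + 1) k (φ m x) = R.approx m (k + 1) x := by
  have hcast : ∀ {n n' : ℕ} (_ : n = n') (h : m ≤ n) (h' : m ≤ n'),
      R.ψ n (iterHom φ h x) = R.ψ n' (iterHom φ h' x) := by
    rintro n _ rfl _ _
    rfl
  exact (congrArg (R.ψ (m + 1 + k)) (iterHom_succ_left φ _ x)).trans (hcast (by omega) _ _)

theorem norm_approx_succ_sub_le (m k : ℕ) (x : A m) (f : H) :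
    ‖R.approx m (k + 1) x f - R.approx m k x f‖ ≤ ‖x‖ * R.w f (k + m) := by
  rw [R.approx_succ, add_comm k m]
  exact (R.step_le (m + k) _ f).trans
    (mul_le_mul_of_nonneg_right (norm_iterHom_le φ _ x) (R.w_nonneg _ _))

theorem summable_add {f : H} (hf : f ∈ R.D) (m : ℕ) : Summable fun k => R.w f (k + m) :=
  (summable_nat_add_iff m).2 (R.summable f hf)

theorem exists_limit (m : ℕ) (x : A m) :
    ∃ T : H →L[ℂ] H, ∀ f, Tendsto (fun k => R.approx m k x f) atTop (𝓝 (T f)) := by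
  refine exists_tendsto_apply_of_dense (fun k => R.norm_approx_le m k x) R.dense fun f hf => ?_
  refine cauchySeq_of_dist_le_of_summable (fun k => ‖x‖ * R.w f (k + m)) (fun k => ?_)
    ((R.summable_add hf m).mul_left _)
  rw [dist_comm, dist_eq_norm]
  exact R.norm_approx_succ_sub_le m k x f

/-- The strong limit of the representations `approx m k` as `k → ∞`. -/
noncomputable def limit (m : ℕ) : A m →⋆ₐ[ℂ] (H →L[ℂ] H) :=
  strongLimit (R.approx m) (fun x => (R.exists_limit m x).choose)
    fun x => (R.exists_limit m x).choose_spec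

theorem tendsto_limit (m : ℕ) (x : A m) (f : H) :
    Tendsto (fun k => R.approx m k x f) atTop (𝓝 (R.limit m x f)) :=
  (R.exists_limit m x).choose_spec f

theorem limit_succ (m : ℕ) (x : A m) : R.limit (m + 1) (φ m x) = R.limit m x := by
  ext f
  refine tendsto_nhds_unique (R.tendsto_limit (m + 1) (φ m x) f)
    (((tendsto_add_atTop_iff_nat 1).2 (R.tendsto_limit m x f)).congr fun k => ?_)
  rw [R.approx_step]

theorem norm_limit_sub_le (m : ℕ) (x : A m) {f : H} (hf : f ∈ R.D) :
    ‖R.limit m x f - R.ψ m x f‖ ≤ ‖x‖ * ∑' k, R.w f (k + m) := by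
  have hpartial (k : ℕ) :
      ‖R.approx m k x f - R.ψ m x f‖ ≤ ‖x‖ * ∑ j ∈ Finset.range k, R.w f (j + m) := by
    induction k with
    | zero => simp [R.approx_zero]
    | succ k ih =>
      rw [Finset.sum_range_succ, mul_add, add_comm (‖x‖ * _)]
      exact (norm_sub_le_norm_sub_add_norm_sub _ (R.approx m k x f) _).trans
        (add_le_add (R.norm_approx_succ_sub_le m k x f) ih)
  refine le_of_tendsto ((R.tendsto_limit m x f).sub_const _).norm (Eventually.of_forall fun k => ?_)
  refine (hpartial k).trans (mul_le_mul_of_nonneg_left ?_ (norm_nonneg _))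
  exact (R.summable_add hf m).sum_le_tsum _ fun j _ => R.w_nonneg _ _

theorem tendsto_limit_iterHom {d : ∀ m, A m →⋆ₐ[ℂ] A (m + 1)}
    (hd : ∀ m x, R.ψ (m + 1) (d m x) = R.ψ m x) (m : ℕ) (x : A m) (f : H) :
    Tendsto (fun k => R.limit (m + k) (iterHom d (Nat.le_add_right m k) x) f) atTop
      (𝓝 (R.ψ m x f)) := by
  refine tendsto_apply_of_dense (C := ‖x‖) (fun k => ?_) R.dense (fun f hf => ?_) f
  · exact (NonUnitalStarAlgHom.norm_apply_le (R.limit (m + k)) _).trans (norm_iterHom_le d _ x)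
  rw [tendsto_iff_norm_sub_tendsto_zero]
  have htail : Tendsto (fun k => ‖x‖ * ∑' j, R.w f (j + (m + k))) atTop (𝓝 0) := by
    simpa [Function.comp_def, add_comm] using
      ((tendsto_sum_nat_add (R.w f)).comp (tendsto_add_atTop_nat m)).const_mul ‖x‖
  refine squeeze_zero (fun k => norm_nonneg _) (fun k => ?_) htail
  have hlimit := R.norm_limit_sub_le (m + k) (iterHom d (Nat.le_add_right m k) x) hf
  rw [map_iterHom d (F := fun m => R.ψ m) hd] at hlimit
  exact hlimit.trans (mul_le_mul_of_nonneg_right (norm_iterHom_le d _ x)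
    (tsum_nonneg fun j => R.w_nonneg _ _))

theorem centralizer_iUnion_range_limit {d : ∀ m, A m →⋆ₐ[ℂ] A (m + 1)}
    (hd : ∀ m x, R.ψ (m + 1) (d m x) = R.ψ m x) :
    (⋃ m, Set.range (R.limit m)).centralizer = (⋃ m, Set.range (R.ψ m)).centralizer := by
  ext S
  simp only [Set.mem_centralizer_iff, Set.mem_iUnion, forall_exists_index, Set.forall_mem_range,
    forall_comm (α := H →L[ℂ] H)]
  refine ⟨fun h m x => ?_, fun h m x => ?_⟩
  · exact (commute_of_tendsto_apply (R.tendsto_limit_iterHom hd m x)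
      fun k => (h (m + k) _).symm).symm
  · exact (commute_of_tendsto_apply (R.tendsto_limit m x) fun k => (h (m + k) _).symm).symm

end AsymptoticRep

end InductiveSequences

section PauliUnits

/-- The matrix units of the copy of `M_2(ℂ)` generated by a pair of anticommuting involutions `X`
and `Z`: the projections `(1 ± Z) / 2` are the diagonal units, and `X` exchanges them. -/
noncomputable def pauliUnit {B : Type*} [Ring B] [Algebra ℂ B] (X Z : B) (a b : Fin 2) : B :=
  (if a = b then 1 else X) * ((1 / 2 : ℂ) • (1 + (if b = 0 then Z else -Z)))

variable {B : Type*} [Ring B] [Algebra ℂ B]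

theorem isMatrixUnits_pauliUnit [StarRing B] [StarModule ℂ B] {X Z : B} (hX : star X = X)
    (hZ : star Z = Z) (hXX : X * X = 1) (hZZ : Z * Z = 1) (hXZ : X * Z = -(Z * X)) :
    IsMatrixUnits (pauliUnit X Z) := by
  let Q (b : Fin 2) : B := (1 / 2 : ℂ) • (1 + (if b = 0 then Z else -Z))
  have hunit (a b) : pauliUnit X Z a b = (if a = b then 1 else X) * Q b := rfl
  have hQQ (b c) : Q b * Q c = if b = c then Q b else 0 := by
    fin_cases b <;> fin_cases c <;> simp [Q, mul_add, add_mul, hZZ] <;> module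
  have hQX (b) : Q b * X = X * Q (1 - b) := by
    have hZX : Z * X = -(X * Z) := by rw [hXZ, neg_neg]
    fin_cases b <;> simp [Q, mul_add, add_mul, hZX]
  have hQXQ (b c) : Q b * (X * Q c) = if b = 1 - c then X * Q c else 0 := by
    rw [← mul_assoc, hQX, mul_assoc, hQQ]
    fin_cases b <;> fin_cases c <;> simp
  have hXXQ (b) : X * (X * Q b) = Q b := by rw [← mul_assoc, hXX, one_mul]
  have hQ_star (b) : star (Q b) = Q b := by fin_cases b <;> simp [Q, hZ]
  refine ⟨fun i j k l => ?_, fun i j => ?_, ?_⟩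
  · rw [hunit, hunit, hunit]
    fin_cases i <;> fin_cases j <;> fin_cases k <;> fin_cases l <;>
      simp [hQQ, hQXQ, hXXQ, mul_assoc]
  · rw [hunit, hunit, star_mul, hQ_star]
    fin_cases i <;> fin_cases j <;> simp [hX, hQX]
  · simp only [hunit, Fin.sum_univ_two, if_true, one_mul]
    simp only [Q, if_true, if_neg one_ne_zero]
    module

theorem forall_commute_pauliUnit_iff {X Z T : B} :
    (∀ a b, Commute T (pauliUnit X Z a b)) ↔ Commute T X ∧ Commute T Z := by
  refine ⟨fun h => ?_, fun ⟨hX, hZ⟩ a b => ?_⟩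
  · have hX : X = pauliUnit X Z 1 0 + pauliUnit X Z 0 1 := by
      simp only [pauliUnit, one_ne_zero, zero_ne_one, if_false, if_true, mul_smul_comm, mul_add,
        mul_one, mul_neg]
      module
    have hZ : Z = pauliUnit X Z 0 0 - pauliUnit X Z 1 1 := by
      simp only [pauliUnit, one_ne_zero, if_false, if_true, one_mul]
      module
    exact ⟨hX ▸ (h 1 0).add_right (h 0 1), hZ ▸ (h 0 0).sub_right (h 1 1)⟩
  · refine Commute.mul_right ?_ (((Commute.one_right T).add_right ?_).smul_right _)
    · split_ifs
      exacts [Commute.one_right T, hX]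
    · split_ifs
      exacts [hZ, hZ.neg_right]

end PauliUnits

namespace IsMatrixUnits

variable {n m B : Type*} [Fintype n] [DecidableEq n] [Fintype m] [DecidableEq m] [Ring B]
  [StarRing B] {F : n → n → B} {G : m → m → B}

theorem prod {k : Type*} [Fintype k] [DecidableEq k] (hF : IsMatrixUnits F) (hG : IsMatrixUnits G)
    (hc : ∀ a b c d, Commute (F a b) (G c d)) (e : k ≃ n × m) :
    IsMatrixUnits fun p q => F (e p).1 (e q).1 * G (e p).2 (e q).2 where
  mul_eq i j p q := by
    have heq : j = p ↔ (e j).2 = (e p).2 ∧ (e j).1 = (e p).1 := by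
      rw [and_comm, ← Prod.ext_iff, e.apply_eq_iff_eq]
    rw [mul_assoc, ← mul_assoc (G _ _), ← (hc _ _ _ _).eq, mul_assoc, hG.mul_eq, ← mul_assoc,
      hF.mul_eq]
    simp only [heq, ite_and, ite_mul, mul_ite, zero_mul, mul_zero]
  star_eq i j := by rw [star_mul, hF.star_eq, hG.star_eq, (hc _ _ _ _).eq]
  sum_eq := by
    rw [e.sum_comp (fun p => F p.1 p.1 * G p.2 p.2), Fintype.sum_prod_type]
    simp only [← Finset.mul_sum, hG.sum_eq, mul_one, hF.sum_eq]

theorem forall_commute_mul_iff (hF : IsMatrixUnits F) (hG : IsMatrixUnits G) {T : B} :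
    (∀ a b c d, Commute T (F a b * G c d)) ↔
      (∀ a b, Commute T (F a b)) ∧ ∀ c d, Commute T (G c d) := by
  refine ⟨fun h => ⟨fun a b => ?_, fun c d => ?_⟩, fun h a b c d => (h.1 a b).mul_right (h.2 c d)⟩
  · rw [← mul_one (F a b), ← hG.sum_eq, Finset.mul_sum]
    exact Commute.sum_right _ _ _ fun c _ => h a b c c
  · rw [← one_mul (G c d), ← hF.sum_eq, Finset.sum_mul]
    exact Commute.sum_right _ _ _ fun a _ => h a a c d

end IsMatrixUnits

/-- Operators satisfying the relations of the Pauli matrices of the factors of an infinite tensor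
power of `M_2(ℂ)`, together with an increasing sequence of subspaces `V s` on which the first `s`
pairs act, and on which the compressions of the `s`-th pair and of its product vanish. The latter
says that vector states from `V s` restrict to multiples of the trace on the `s`-th factor. -/
structure PauliSystem (H : Type*) [NormedAddCommGroup H] [InnerProductSpace ℂ H]
    [CompleteSpace H] where
  X : ℕ → H →L[ℂ] H
  Z : ℕ → H →L[ℂ] H
  star_X : ∀ i, star (X i) = X i
  star_Z : ∀ i, star (Z i) = Z i
  X_mul_X : ∀ i, X i * X i = 1
  Z_mul_Z : ∀ i, Z i * Z i = 1
  X_mul_Z : ∀ i, X i * Z i = -(Z i * X i)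
  commute_XX : ∀ i j, Commute (X i) (X j)
  commute_ZZ : ∀ i j, Commute (Z i) (Z j)
  commute_XZ : ∀ i j, i ≠ j → Commute (X i) (Z j)
  V : ℕ → Submodule ℂ H
  mono : Monotone V
  dense : Dense (⋃ s, (V s : Set H))
  X_mem : ∀ i s, i < s → ∀ f ∈ V s, X i f ∈ V s
  Z_mem : ∀ i s, i < s → ∀ f ∈ V s, Z i f ∈ V s
  inner_X : ∀ s, ∀ f ∈ V s, ∀ g ∈ V s, inner ℂ f (X s g) = 0
  inner_Z : ∀ s, ∀ f ∈ V s, ∀ g ∈ V s, inner ℂ f (Z s g) = 0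
  inner_XZ : ∀ s, ∀ f ∈ V s, ∀ g ∈ V s, inner ℂ f (X s (Z s g)) = 0

namespace PauliSystem

variable {H : Type*} [NormedAddCommGroup H] [InnerProductSpace ℂ H] [CompleteSpace H]
  (P : PauliSystem H)

/-- The operator `T` commutes with the `i`-th copy of `M_2(ℂ)`. -/
def CommutesWithFactor (i : ℕ) (T : H →L[ℂ] H) : Prop :=
  Commute T (P.X i) ∧ Commute T (P.Z i)

theorem commutesWithFactor_X {i j : ℕ} (h : i ≠ j) : P.CommutesWithFactor j (P.X i) :=
  ⟨P.commute_XX i j, P.commute_XZ i j h⟩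

theorem commutesWithFactor_Z {i j : ℕ} (h : i ≠ j) : P.CommutesWithFactor j (P.Z i) :=
  ⟨(P.commute_XZ j i h.symm).symm, P.commute_ZZ i j⟩

/-- The matrix units `F` span the algebra generated by the `l` pairs with indices in
`[s, s + l)`. -/
structure IsBlock (s l : ℕ) {n : Type*} [Fintype n] [DecidableEq n] (F : n → n → H →L[ℂ] H) : Prop
    extends IsMatrixUnits F where
  forall_commute_iff : ∀ T, (∀ a b, Commute T (F a b)) ↔
    ∀ i ∈ Set.Ico s (s + l), P.CommutesWithFactor i T
  inner_eq : ∀ a b, ∀ f ∈ P.V s, ∀ g ∈ P.V s,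
    inner ℂ f (F a b g) = if a = b then (1 / 2 : ℂ) ^ l * inner ℂ f g else 0
  mem : ∀ t, s + l ≤ t → ∀ a b, ∀ f ∈ P.V t, F a b f ∈ P.V t

theorem isBlock_zero (s : ℕ) (n : Type*) [Unique n] [DecidableEq n] :
    P.IsBlock s 0 fun _ _ : n => 1 where
  mul_eq _ j k _ := by simp [Subsingleton.elim j k]
  star_eq _ _ := star_one _
  sum_eq := by simp
  forall_commute_iff T := by simp
  inner_eq a b f _ g _ := by simp [Subsingleton.elim a b]
  mem _ _ _ _ _ hf := hf

theorem isBlock_pauliUnit (i : ℕ) : P.IsBlock i 1 (pauliUnit (P.X i) (P.Z i)) where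
  toIsMatrixUnits := isMatrixUnits_pauliUnit (P.star_X i) (P.star_Z i) (P.X_mul_X i) (P.Z_mul_Z i)
    (P.X_mul_Z i)
  forall_commute_iff T := by
    rw [forall_commute_pauliUnit_iff, Set.Ico_add_one_right_eq_Icc, Set.Icc_self]
    simp only [Set.mem_singleton_iff, forall_eq, CommutesWithFactor]
  inner_eq a b f hf g hg := by
    fin_cases a <;> fin_cases b <;>
      simp [pauliUnit, inner_smul_right, P.inner_X i f hf g hg, P.inner_Z i f hf g hg,
        P.inner_XZ i f hf g hg]
  mem t ht a b f hf := by
    have hdiag : ((1 / 2 : ℂ) • (1 + (if b = 0 then P.Z i else -P.Z i))) f ∈ P.V t := by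
      refine (P.V t).smul_mem _ ((P.V t).add_mem hf ?_)
      split_ifs
      · exact P.Z_mem i t ht f hf
      · exact (P.V t).neg_mem (P.Z_mem i t ht f hf)
    rw [pauliUnit, mul_apply_eq_comp]
    obtain hab | hab := eq_or_ne a b
    · rwa [if_pos hab, one_apply_eq_self]
    · rw [if_neg hab]
      exact P.X_mem i t ht _ hdiag

namespace IsBlock

variable {P} {s l l' : ℕ} {n m : Type*} [Fintype n] [DecidableEq n] [Fintype m] [DecidableEq m]
  {F : n → n → H →L[ℂ] H} {G : m → m → H →L[ℂ] H}

theorem commutesWithFactor (hF : P.IsBlock s l F) {i : ℕ} (hi : i ∉ Set.Ico s (s + l)) (a b : n) :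
    P.CommutesWithFactor i (F a b) :=
  have hne {j : ℕ} (hj : j ∈ Set.Ico s (s + l)) : i ≠ j := fun h => hi (h ▸ hj)
  ⟨((hF.forall_commute_iff _).2 (fun _ hj => P.commutesWithFactor_X (hne hj)) a b).symm,
    ((hF.forall_commute_iff _).2 (fun _ hj => P.commutesWithFactor_Z (hne hj)) a b).symm⟩

theorem prod {k : Type*} [Fintype k] [DecidableEq k] (hF : P.IsBlock s l F)
    (hG : P.IsBlock (s + l) l' G) (e : k ≃ n × m) :
    P.IsBlock s (l + l') fun p q => F (e p).1 (e q).1 * G (e p).2 (e q).2 := by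
  have hc (a b c d) : Commute (F a b) (G c d) :=
    (hG.forall_commute_iff _).2 (fun i hi => hF.commutesWithFactor (fun h => hi.1.not_gt h.2) a b)
      c d
  refine ⟨hF.toIsMatrixUnits.prod hG.toIsMatrixUnits hc e, fun T => ?_, fun p q f hf g hg => ?_,
    fun t ht p q f hf => hF.mem t (by omega) _ _ _ (hG.mem t (by omega) _ _ f hf)⟩
  · calc (∀ p q, Commute T (F (e p).1 (e q).1 * G (e p).2 (e q).2)) ↔
          ∀ a b c d, Commute T (F a b * G c d) :=
        ⟨fun h a b c d => by simpa using h (e.symm (a, c)) (e.symm (b, d)),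
          fun h p q => h _ _ _ _⟩
      _ ↔ (∀ i ∈ Set.Ico s (s + l), P.CommutesWithFactor i T) ∧
          ∀ i ∈ Set.Ico (s + l) (s + l + l'), P.CommutesWithFactor i T := by
        rw [hF.forall_commute_mul_iff hG.toIsMatrixUnits, hF.forall_commute_iff,
          hG.forall_commute_iff]
      _ ↔ ∀ i ∈ Set.Ico s (s + (l + l')), P.CommutesWithFactor i T := by
        rw [← add_assoc, ← Set.Ico_union_Ico_eq_Ico (Nat.le_add_right s l)
          (Nat.le_add_right (s + l) l')]
        simp only [Set.mem_union, or_imp, forall_and]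
  · have hmono := P.mono (Nat.le_add_right s l)
    have heq : p = q ↔ (e p).2 = (e q).2 ∧ (e p).1 = (e q).1 := by
      rw [and_comm, ← Prod.ext_iff, e.apply_eq_iff_eq]
    rw [(hc _ _ _ _).eq, mul_apply_eq_comp,
      hG.inner_eq _ _ f (hmono hf) _ (hF.mem _ le_rfl _ _ _ (hmono hg)),
      hF.inner_eq _ _ f hf g hg]
    simp only [heq, ite_and, mul_ite, mul_zero, pow_add]
    ring_nf

theorem inner_sum_mul_apply (hF : P.IsBlock s l F) {W : n → n → H →L[ℂ] H}
    (hc : ∀ a b, Commute (W a b) (F a b)) (hW : ∀ a b, ∀ g ∈ P.V s, W a b g ∈ P.V s) {f g : H}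
    (hf : f ∈ P.V s) (hg : g ∈ P.V s) :
    inner ℂ f ((∑ a, ∑ b, W a b * F a b) g) =
      (1 / 2 : ℂ) ^ l * ∑ a, inner ℂ f (W a a g) := by
  have hterm (a b) : inner ℂ f ((W a b * F a b) g) =
      if a = b then (1 / 2 : ℂ) ^ l * inner ℂ f (W a b g) else 0 := by
    rw [(hc a b).eq, mul_apply_eq_comp, hF.inner_eq a b f hf _ (hW a b g hg)]
  simp only [_root_.sum_apply, inner_sum, hterm, Finset.sum_ite_eq, Finset.mem_univ, if_true,
    Finset.mul_sum]

end IsBlock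

theorem exists_isBlock (s l : ℕ) :
    ∃ F : Fin (2 ^ l) → Fin (2 ^ l) → H →L[ℂ] H, P.IsBlock s l F := by
  induction l with
  | zero =>
    let _ : Unique (Fin (2 ^ 0)) := inferInstanceAs (Unique (Fin 1))
    exact ⟨fun _ _ => 1, P.isBlock_zero s _⟩
  | succ l ih =>
    obtain ⟨F, hF⟩ := ih
    exact ⟨_, hF.prod (P.isBlock_pauliUnit (s + l))
      ((finCongr (pow_succ 2 l)).trans finProdFinEquiv.symm)⟩

end PauliSystem

namespace Tower

variable {E : Type u} [CStarAlgebra E] (T : Tower E)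

/-- The connecting map `A m → A (m + 1)`. -/
noncomputable def step (m : ℕ) : T.A m →⋆ₐ[ℂ] T.A (m + 1) :=
  (T.iso m).symm.toStarAlgHom.comp (connectingMap (T.rep m))

/-- The amplification `x ↦ diag(x, …, x)`, as a map `A m → A (m + 1)`. -/
noncomputable def amp (m : ℕ) : T.A m →⋆ₐ[ℂ] T.A (m + 1) :=
  (T.iso m).symm.toStarAlgHom.comp (matrixAmplification _ _)

/-- The embedding of the scalar matrices in `A (m + 1)`. -/
noncomputable def scalar (m : ℕ) :
    CStarMatrix (Fin (2 ^ T.l m)) (Fin (2 ^ T.l m)) ℂ →⋆ₐ[ℂ] T.A (m + 1) :=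
  (T.iso m).symm.toStarAlgHom.comp (scalarMatrix _ _)

theorem iso_step (m : ℕ) (x : T.A m) : T.iso m (T.step m x) = connectingMap (T.rep m) x :=
  (T.iso m).apply_symm_apply _

theorem iso_amp (m : ℕ) (x : T.A m) : T.iso m (T.amp m x) = matrixAmplification _ _ x :=
  (T.iso m).apply_symm_apply _

theorem iso_scalar (m : ℕ) (M) : T.iso m (T.scalar m M) = scalarMatrix _ _ M :=
  (T.iso m).apply_symm_apply _

theorem scalar_mul_step (m : ℕ) (x : T.A m) :
    T.scalar m (T.rep m 1) * T.step m x = T.scalar m (T.rep m x) :=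
  EquivLike.injective (T.iso m) <| by
    rw [map_mul, iso_scalar, iso_step, iso_scalar, scalarMatrix_mul_connectingMap]

theorem step_mul_scalar (m : ℕ) (x : T.A m) :
    T.step m x * T.scalar m (T.rep m 1) = T.scalar m (T.rep m x) :=
  EquivLike.injective (T.iso m) <| by
    rw [map_mul, iso_scalar, iso_step, iso_scalar, connectingMap_mul_scalarMatrix]

theorem step_mem (m k : ℕ) {x : T.A m} (hx : x ∈ T.G m k) : T.step m x ∈ T.G (m + 1) k :=
  T.connectingMap_mem m k x hx

theorem rep_one_ne_one (m : ℕ) : T.rep m 1 ≠ 1 := by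
  intro h
  have htrace : (∑ i, T.rep m 1 i i).re = 2 ^ T.l m := by
    rw [h]
    simp only [CStarMatrix.one_apply_eq, Finset.sum_const, Finset.card_univ, Fintype.card_fin,
      nsmul_eq_mul, mul_one]
    exact_mod_cast Complex.natCast_re (2 ^ T.l m)
  have hlt : (1 / 4 : ℝ) ^ (m + 1) < 1 := pow_lt_one₀ (by norm_num) (by norm_num) (by omega)
  have hpos : (0 : ℝ) < 2 ^ T.l m := by positivity
  nlinarith [T.trace_le m]

theorem step_injective (m : ℕ) : Function.Injective (T.step m) :=
  (T.iso m).symm.injective.comp (connectingMap_injective (T.rep m) (T.rep_one_ne_one m))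

theorem amp_injective (m : ℕ) : Function.Injective (T.amp m) :=
  (T.iso m).symm.injective.comp fun x y h => by
    simpa [matrixAmplification_apply] using congrFun₂ h 0 0

/-- The number of Pauli pairs used to represent `A m`. -/
def offset (m : ℕ) : ℕ := ∑ j ∈ Finset.range m, T.l j

theorem offset_succ (m : ℕ) : T.offset (m + 1) = T.offset m + T.l m := Finset.sum_range_succ _ _

theorem le_offset (m : ℕ) : m ≤ T.offset m := by
  induction m with
  | zero => exact Nat.zero_le _
  | succ m ih => have := T.l_pos m; rw [offset_succ]; omega

end Tower

/-- The vector state of `Ω` is tracial on the range of the representation `ρ`. -/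
def IsTraceVector {A H : Type*} [CStarAlgebra A] [NormedAddCommGroup H] [InnerProductSpace ℂ H]
    [CompleteSpace H] (ρ : A →⋆ₐ[ℂ] (H →L[ℂ] H)) (Ω : H) : Prop :=
  ∀ x y, inner ℂ Ω (ρ (x * y) Ω) = inner ℂ Ω (ρ (y * x) Ω)

theorem IsTraceVector.of_tendsto {A H ι : Type*} [CStarAlgebra A] [NormedAddCommGroup H]
    [InnerProductSpace ℂ H] [CompleteSpace H] {l : Filter ι} [l.NeBot]
    {u : ι → A →⋆ₐ[ℂ] (H →L[ℂ] H)} {ρ : A →⋆ₐ[ℂ] (H →L[ℂ] H)} {Ω : H}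
    (h : ∀ x, Tendsto (fun k => u k x Ω) l (𝓝 (ρ x Ω))) (hu : ∀ k, IsTraceVector (u k) Ω) :
    IsTraceVector ρ Ω := fun x y =>
  tendsto_nhds_unique (tendsto_const_nhds.inner (h (x * y)))
    ((tendsto_const_nhds.inner (h (y * x))).congr fun k => hu k y x)

theorem norm_sq_apply_of_isStarProjection {H : Type*} [NormedAddCommGroup H]
    [InnerProductSpace ℂ H] [CompleteSpace H] {p : H →L[ℂ] H} (hp : IsStarProjection p) (f : H) :
    (‖p f‖ : ℂ) ^ 2 = inner ℂ f (p f) := by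
  have hadjoint : ContinuousLinearMap.adjoint p = p := hp.isSelfAdjoint.star_eq
  calc (‖p f‖ : ℂ) ^ 2 = inner ℂ (p f) (p f) := by
        rw [inner_self_eq_norm_sq_to_K]
        rfl
    _ = inner ℂ f (p f) := by
      rw [← ContinuousLinearMap.adjoint_inner_right, hadjoint, ← mul_apply_eq_comp,
        hp.isIdempotentElem.eq]

/-- A Pauli system together with a representation of `E` in its commutant which leaves the
subspaces `V s` invariant. -/
structure PauliRep (E : Type u) [CStarAlgebra E] (H : Type*) [NormedAddCommGroup H]
    [InnerProductSpace ℂ H] [CompleteSpace H] extends PauliSystem H where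
  π : E →⋆ₐ[ℂ] (H →L[ℂ] H)
  commutesWithFactor : ∀ i x, toPauliSystem.CommutesWithFactor i (π x)
  π_mem : ∀ x s, ∀ f ∈ V s, π x f ∈ V s

namespace PauliRep

variable {E : Type u} [CStarAlgebra E] {H : Type*} [NormedAddCommGroup H] [InnerProductSpace ℂ H]
  [CompleteSpace H] (P : PauliRep E H)

/-- The Pauli operators and the operators representing `E`. They generate the von Neumann algebra
`R ⊗̄ π(E)''`. -/
def generators : Set (H →L[ℂ] H) := Set.range P.X ∪ Set.range P.Z ∪ Set.range P.π

theorem star_mem_generators {S : H →L[ℂ] H} (hS : S ∈ P.generators) : star S ∈ P.generators := by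
  obtain (⟨i, rfl⟩ | ⟨i, rfl⟩) | ⟨x, rfl⟩ := hS
  · exact .inl (.inl ⟨i, (P.star_X i).symm⟩)
  · exact .inl (.inr ⟨i, (P.star_Z i).symm⟩)
  · exact .inr ⟨star x, map_star P.π x⟩

theorem mem_centralizer_generators_iff {S : H →L[ℂ] H} : S ∈ P.generators.centralizer ↔
    (∀ x, Commute S (P.π x)) ∧ ∀ i, P.CommutesWithFactor i S := by
  simp only [Set.mem_centralizer_iff, generators, Set.mem_union, or_imp, forall_and,
    Set.forall_mem_range, PauliSystem.CommutesWithFactor, commute_iff_eq, eq_comm (b := S * _)]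
  tauto

variable (T : Tower E)

/-- The matrix units which represent the matrix factor of `A (m + 1) = M_{2^l}(A m)`. -/
noncomputable def block (m : ℕ) : Fin (2 ^ T.l m) → Fin (2 ^ T.l m) → H →L[ℂ] H :=
  (P.exists_isBlock (T.offset m) (T.l m)).choose

theorem isBlock_block (m : ℕ) : P.IsBlock (T.offset m) (T.l m) (P.block T m) :=
  (P.exists_isBlock (T.offset m) (T.l m)).choose_spec

theorem commute_block {m : ℕ} {S : H →L[ℂ] H}
    (hS : ∀ i, T.offset m ≤ i → P.CommutesWithFactor i S) (a b) : Commute S (P.block T m a b) :=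
  ((P.isBlock_block T m).forall_commute_iff S).2 (fun i hi => hS i hi.1) a b

/-- The representations of the stages of the tower, together with the fact that they commute with
the Pauli pairs which have not been used so far. -/
noncomputable def commutingStage : ∀ m, {ψ : T.A m →⋆ₐ[ℂ] (H →L[ℂ] H) //
    ∀ x i, T.offset m ≤ i → P.CommutesWithFactor i (ψ x)}
  | 0 => ⟨P.π.comp T.base.symm.toStarAlgHom, fun _ _ _ => P.commutesWithFactor _ _⟩
  | m + 1 =>
    let ψ := commutingStage m
    let hF := P.isBlock_block T m
    let hc := fun a b x => P.commute_block T (ψ.2 x) a b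
    ⟨(hF.lift ψ.1 hc).comp (T.iso m).toStarAlgHom, fun x i hi => by
      rw [T.offset_succ] at hi
      have hψ (y : T.A m) : P.CommutesWithFactor i (ψ.1 y) := ψ.2 y i (by omega)
      have hblock := hF.commutesWithFactor fun h => hi.not_gt h.2
      exact ⟨((hF.forall_commute_lift_iff ψ.1 hc).2
          ⟨fun y => (hψ y).1.symm, fun a b => (hblock a b).1.symm⟩ _).symm,
        ((hF.forall_commute_lift_iff ψ.1 hc).2
          ⟨fun y => (hψ y).2.symm, fun a b => (hblock a b).2.symm⟩ _).symm⟩⟩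

/-- The representation of the stage `A m` of the tower as matrix units tensor `π(E)`. -/
noncomputable def stage (m : ℕ) : T.A m →⋆ₐ[ℂ] (H →L[ℂ] H) := (P.commutingStage T m).1

theorem commute_stage_block (m : ℕ) (a b) (x : T.A m) :
    Commute (P.stage T m x) (P.block T m a b) :=
  P.commute_block T ((P.commutingStage T m).2 x) a b

theorem stage_zero (x : E) : P.stage T 0 (T.base x) = P.π x :=
  congrArg P.π (T.base.symm_apply_apply x)

theorem stage_succ (m : ℕ) (y : T.A (m + 1)) : P.stage T (m + 1) y =
    (P.isBlock_block T m).lift (P.stage T m) (P.commute_stage_block T m) (T.iso m y) := rfl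

theorem stage_amp (m : ℕ) (x : T.A m) : P.stage T (m + 1) (T.amp m x) = P.stage T m x := by
  rw [stage_succ, T.iso_amp, IsMatrixUnits.lift_matrixAmplification]

theorem stage_step_sub (m : ℕ) (x : T.A m) :
    P.stage T (m + 1) (T.step m x) - P.stage T m x =
      (P.stage T (m + 1) (T.scalar m (T.rep m x)) - P.stage T m x) *
        P.stage T (m + 1) (T.scalar m (T.rep m 1)) := by
  simp only [stage_succ, T.iso_scalar, T.iso_step]
  exact IsMatrixUnits.lift_connectingMap_sub _ _ _ _ _

theorem stage_mem {m t : ℕ} (ht : T.offset m ≤ t) (x : T.A m) {f : H} (hf : f ∈ P.V t) :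
    P.stage T m x f ∈ P.V t := by
  induction m generalizing f with
  | zero => exact P.π_mem _ _ f hf
  | succ m ih =>
    rw [T.offset_succ] at ht
    rw [stage_succ, IsMatrixUnits.lift_apply]
    simp only [_root_.sum_apply]
    exact Submodule.sum_mem _ fun a _ => Submodule.sum_mem _ fun b _ =>
      ih (by omega) _ ((P.isBlock_block T m).mem t ht a b f hf)

theorem inner_stage_succ (m : ℕ) (y : T.A (m + 1)) {f g : H} (hf : f ∈ P.V (T.offset m))
    (hg : g ∈ P.V (T.offset m)) : inner ℂ f (P.stage T (m + 1) y g) =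
      (1 / 2 : ℂ) ^ T.l m * ∑ a, inner ℂ f (P.stage T m (T.iso m y a a) g) :=
  (P.isBlock_block T m).inner_sum_mul_apply (fun a b => P.commute_stage_block T m a b _)
    (fun _ _ _ hg => P.stage_mem T le_rfl _ hg) hf hg

theorem inner_stage_scalar (m : ℕ) (M) {f g : H} (hf : f ∈ P.V (T.offset m))
    (hg : g ∈ P.V (T.offset m)) : inner ℂ f (P.stage T (m + 1) (T.scalar m M) g) =
      (1 / 2 : ℂ) ^ T.l m * (∑ a, M a a) * inner ℂ f g := by
  rw [P.inner_stage_succ T m _ hf hg, mul_assoc, Finset.sum_mul, T.iso_scalar]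
  simp only [scalarMatrix_apply, Algebra.algebraMap_eq_smul_one, map_smul, map_one,
    _root_.smul_apply, one_apply_eq_self, inner_smul_right]

theorem forall_commute_stage_iff (m : ℕ) {S : H →L[ℂ] H} : (∀ x, Commute S (P.stage T m x)) ↔
    (∀ x, Commute S (P.π x)) ∧ ∀ i < T.offset m, P.CommutesWithFactor i S := by
  induction m with
  | zero =>
    simp only [Tower.offset, Finset.range_zero, Finset.sum_empty, not_lt_zero, false_imp_iff,
      implies_true, and_true]
    exact ⟨fun h x => P.stage_zero T x ▸ h _, fun h x => h _⟩
  | succ m ih =>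
    have hsplit (i : ℕ) : i < T.offset (m + 1) ↔
        i < T.offset m ∨ i ∈ Set.Ico (T.offset m) (T.offset m + T.l m) := by
      rw [T.offset_succ, Set.mem_Ico]
      omega
    let φ := (P.isBlock_block T m).lift (P.stage T m) (P.commute_stage_block T m)
    have hφ : (∀ y, Commute S (P.stage T (m + 1) y)) ↔ ∀ y, Commute S (φ y) :=
      ((EquivLike.surjective (T.iso m)).forall (p := fun y => Commute S (φ y))).symm
    rw [hφ, IsMatrixUnits.forall_commute_lift_iff, ih, (P.isBlock_block T m).forall_commute_iff,
      and_assoc]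
    simp only [hsplit, or_imp, forall_and]

theorem centralizer_iUnion_range_stage :
    (⋃ m, Set.range (P.stage T m)).centralizer = P.generators.centralizer := by
  ext S
  have hstage : S ∈ (⋃ m, Set.range (P.stage T m)).centralizer ↔
      ∀ m x, Commute S (P.stage T m x) := by
    simp only [Set.mem_centralizer_iff, Set.mem_iUnion, forall_exists_index,
      Set.forall_mem_range, forall_comm (α := H →L[ℂ] H), commute_iff_eq, eq_comm (b := S * _)]
  simp only [hstage, mem_centralizer_generators_iff, P.forall_commute_stage_iff T]
  exact ⟨fun h => ⟨(h 0).1, fun i => (h (i + 1)).2 i (T.le_offset (i + 1))⟩,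
    fun h m => ⟨h.1, fun i _ => h.2 i⟩⟩

/-- The range projection of the finite dimensional part of the connecting map `T.step m`. -/
noncomputable def proj (m : ℕ) : H →L[ℂ] H := P.stage T (m + 1) (T.scalar m (T.rep m 1))

theorem isStarProjection_proj (m : ℕ) : IsStarProjection (P.proj T m) :=
  (((IsStarProjection.one (R := T.A m)).map (T.rep m)).map (T.scalar m)).map (P.stage T (m + 1))

theorem norm_proj_apply_le (m : ℕ) {f : H} (hf : f ∈ P.V (T.offset m)) :
    ‖P.proj T m f‖ ≤ (1 / 2) ^ (m + 1) * ‖f‖ := by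
  have hnorm : ‖P.proj T m f‖ ^ 2 = (1 / 2) ^ T.l m * (∑ a, T.rep m 1 a a).re * ‖f‖ ^ 2 := by
    have hinner : (‖P.proj T m f‖ : ℂ) ^ 2 =
        ((1 / 2 : ℝ) ^ T.l m * ‖f‖ ^ 2 : ℝ) * ∑ a, T.rep m 1 a a := by
      rw [norm_sq_apply_of_isStarProjection (P.isStarProjection_proj T m), proj,
        P.inner_stage_scalar T m _ hf hf, inner_self_eq_norm_sq_to_K]
      push_cast
      rw [mul_right_comm]
      rfl
    rw [← Complex.ofReal_pow] at hinner
    rw [← Complex.ofReal_re (‖P.proj T m f‖ ^ 2), hinner, Complex.re_ofReal_mul]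
    ring
  refine le_of_sq_le_sq ?_ (by positivity)
  calc ‖P.proj T m f‖ ^ 2 = (1 / 2) ^ T.l m * (∑ a, T.rep m 1 a a).re * ‖f‖ ^ 2 := hnorm
    _ ≤ (1 / 2) ^ T.l m * ((1 / 4) ^ (m + 1) * 2 ^ T.l m) * ‖f‖ ^ 2 := by
      gcongr
      exact T.trace_le m
    _ = (1 / 4) ^ (m + 1) * (1 / 2 * 2) ^ T.l m * ‖f‖ ^ 2 := by
      rw [mul_pow]
      ring
    _ = ((1 / 2) ^ (m + 1) * ‖f‖) ^ 2 := by
      rw [mul_pow _ ‖f‖, ← pow_mul, mul_comm (m + 1) 2, pow_mul]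
      norm_num

theorem summable_norm_proj_apply {f : H} (hf : f ∈ ⋃ s, (P.V s : Set H)) :
    Summable fun m => 2 * ‖P.proj T m f‖ := by
  obtain ⟨s, hs⟩ := Set.mem_iUnion.1 hf
  refine (summable_nat_add_iff s).1 <|
    Summable.of_nonneg_of_le (fun m => by positivity) (fun m => ?_)
      (summable_geometric_two.mul_right ‖f‖)
  have hf' : f ∈ P.V (T.offset (m + s)) :=
    P.mono ((Nat.le_add_left s m).trans (T.le_offset _)) hs
  calc 2 * ‖P.proj T (m + s) f‖ ≤ 2 * ((1 / 2) ^ (m + s + 1) * ‖f‖) := by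
        gcongr
        exact P.norm_proj_apply_le T (m + s) hf'
    _ = (1 / 2) ^ (m + s) * ‖f‖ := by ring
    _ ≤ (1 / 2) ^ m * ‖f‖ := by
        gcongr ?_ * _
        exact pow_le_pow_of_le_one (by norm_num) (by norm_num) (Nat.le_add_right m s)

theorem norm_stage_step_sub_le (m : ℕ) (x : T.A m) (f : H) :
    ‖P.stage T (m + 1) (T.step m x) f - P.stage T m x f‖ ≤ ‖x‖ * (2 * ‖P.proj T m f‖) := by
  let S := P.stage T (m + 1) (T.scalar m (T.rep m x))
  have hS : ‖S‖ ≤ ‖x‖ :=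
    NonUnitalStarAlgHom.norm_apply_le
      (((P.stage T (m + 1)).comp (T.scalar m)).toNonUnitalStarAlgHom.comp (T.rep m)) x
  have hstage : ‖P.stage T m x‖ ≤ ‖x‖ := NonUnitalStarAlgHom.norm_apply_le (P.stage T m) x
  calc ‖P.stage T (m + 1) (T.step m x) f - P.stage T m x f‖ =
        ‖S (P.proj T m f) - P.stage T m x (P.proj T m f)‖ :=
      congrArg norm (DFunLike.congr_fun (P.stage_step_sub T m x) f)
    _ ≤ ‖x‖ * ‖P.proj T m f‖ + ‖x‖ * ‖P.proj T m f‖ :=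
      (norm_sub_le _ _).trans
        (add_le_add (S.le_of_opNorm_le hS _) ((P.stage T m x).le_of_opNorm_le hstage _))
    _ = ‖x‖ * (2 * ‖P.proj T m f‖) := by ring

/-- The asymptotically compatible representations of the stages of the tower. -/
noncomputable def asymptoticRep : AsymptoticRep T.step H where
  ψ := P.stage T
  w f m := 2 * ‖P.proj T m f‖
  w_nonneg f m := by positivity
  D := ⋃ s, (P.V s : Set H)
  dense := P.dense
  summable _ := P.summable_norm_proj_apply T
  step_le := P.norm_stage_step_sub_le T

theorem centralizer_iUnion_range_limit :
    (⋃ m, Set.range ((P.asymptoticRep T).limit m)).centralizer = P.generators.centralizer :=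
  ((P.asymptoticRep T).centralizer_iUnion_range_limit (P.stage_amp T)).trans
    (P.centralizer_iUnion_range_stage T)

variable {Ω : H}

theorem isTraceVector_stage (hΩ : Ω ∈ P.V 0) (htrace : IsTraceVector P.π Ω) (m : ℕ) :
    IsTraceVector (P.stage T m) Ω := by
  have hV (m : ℕ) : Ω ∈ P.V (T.offset m) := P.mono (Nat.zero_le _) hΩ
  induction m with
  | zero =>
    intro x y
    have hbase := htrace (T.base.symm x) (T.base.symm y)
    rwa [← map_mul, ← map_mul] at hbase
  | succ m ih =>
    intro x y
    rw [P.inner_stage_succ T m _ (hV m) (hV m), P.inner_stage_succ T m _ (hV m) (hV m), map_mul,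
      map_mul]
    simp only [CStarMatrix.mul_apply, map_sum, _root_.sum_apply, inner_sum]
    rw [Finset.sum_comm]
    simp only [ih _ _]

theorem isTraceVector_limit (hΩ : Ω ∈ P.V 0) (htrace : IsTraceVector P.π Ω) (m : ℕ) :
    IsTraceVector ((P.asymptoticRep T).limit m) Ω := by
  refine .of_tendsto (fun x => (P.asymptoticRep T).tendsto_limit m x Ω) fun k x y => ?_
  simp only [AsymptoticRep.approx, StarAlgHom.comp_apply, map_mul (iterHom _ _)]
  exact P.isTraceVector_stage T hΩ htrace (m + k) _ _

theorem norm_limit_apply_sub_le (hΩ : Ω ∈ P.V 0) (m : ℕ) (x : T.A m) :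
    ‖(P.asymptoticRep T).limit m x Ω - P.stage T m x Ω‖ ≤ ‖x‖ * (2 * (1 / 2) ^ m * ‖Ω‖) := by
  have hmem : Ω ∈ (P.asymptoticRep T).D := Set.mem_iUnion.2 ⟨0, hΩ⟩
  have hle (k : ℕ) : (P.asymptoticRep T).w Ω (k + m) ≤ (1 / 2) ^ k * ((1 / 2) ^ m * ‖Ω‖) :=
    calc 2 * ‖P.proj T (k + m) Ω‖ ≤ 2 * ((1 / 2) ^ (k + m + 1) * ‖Ω‖) := by
          gcongr
          exact P.norm_proj_apply_le T (k + m) (P.mono (Nat.zero_le _) hΩ)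
      _ = (1 / 2) ^ k * ((1 / 2) ^ m * ‖Ω‖) := by ring
  have htsum : ∑' k, (P.asymptoticRep T).w Ω (k + m) ≤ 2 * (1 / 2) ^ m * ‖Ω‖ := by
    refine (((P.asymptoticRep T).summable_add hmem m).tsum_le_tsum hle
      (summable_geometric_two.mul_right _)).trans_eq ?_
    rw [tsum_mul_right, tsum_geometric_two, mul_assoc]
  exact ((P.asymptoticRep T).norm_limit_sub_le m x hmem).trans
    (mul_le_mul_of_nonneg_left htsum (norm_nonneg _))

end PauliRep

theorem dense_iUnion_coe_iff {F : Type*} [NormedAddCommGroup F] [NormedSpace ℂ F]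
    {V : ℕ → Submodule ℂ F} (hV : Monotone V) :
    Dense (⋃ s, (V s : Set F)) ↔ (⨆ s, V s).topologicalClosure = ⊤ := by
  rw [← Submodule.coe_iSup_of_directed V hV.directed_le,
    Submodule.dense_iff_topologicalClosure_eq_top]

section OperatorTensor

variable {H : Type u} [NormedAddCommGroup H] [InnerProductSpace ℂ H]
  {K : Type v} [NormedAddCommGroup K] [InnerProductSpace ℂ K]

/-- The elementary tensor `ξ ⊗ η` in the Hilbert space tensor product. -/
noncomputable def hilbertTmul : H →L[ℂ] K →L[ℂ] HilbertTensor H K :=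
  (ContinuousLinearMap.compL ℂ K (H ⊗[ℂ] K) (HilbertTensor H K)
    UniformSpace.Completion.toComplL).comp (TensorProduct.mkL ℂ H K)

theorem inner_hilbertTmul (ξ ξ' : H) (η η' : K) :
    inner ℂ (hilbertTmul ξ η) (hilbertTmul ξ' η') = inner ℂ ξ ξ' * inner ℂ η η' := by
  simp [hilbertTmul]

theorem operatorTensor_hilbertTmul (x : H →L[ℂ] H) (y : K →L[ℂ] K) (ξ : H) (η : K) :
    operatorTensor x y (hilbertTmul ξ η) = hilbertTmul (x ξ) (y η) := by
  simp [operatorTensor, hilbertTmul]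

theorem eq_top_of_hilbertTmul_mem {L : Submodule ℂ (HilbertTensor H K)}
    (hL : IsClosed (L : Set (HilbertTensor H K))) (h : ∀ ξ η, hilbertTmul ξ η ∈ L) : L = ⊤ := by
  have hcoe (t : H ⊗[ℂ] K) : (t : HilbertTensor H K) ∈ L := by
    induction t with
    | zero => exact UniformSpace.Completion.coe_zero (α := H ⊗[ℂ] K) ▸ L.zero_mem
    | tmul ξ η => exact h ξ η
    | add a b ha hb => exact UniformSpace.Completion.coe_add a b ▸ L.add_mem ha hb
  exact eq_top_iff.2 fun z _ => UniformSpace.Completion.induction_on z hL hcoe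

theorem hilbertTensor_hom_ext {F : Type*} [NormedAddCommGroup F] [NormedSpace ℂ F]
    {S T : HilbertTensor H K →L[ℂ] F}
    (h : ∀ ξ η, S (hilbertTmul ξ η) = T (hilbertTmul ξ η)) : S = T :=
  ContinuousLinearMap.coe_injective <| LinearMap.eqLocus_eq_top.1 <|
    eq_top_of_hilbertTmul_mem (isClosed_eq S.continuous T.continuous) h

theorem operatorTensor_mul (x x' : H →L[ℂ] H) (y y' : K →L[ℂ] K) :
    operatorTensor x y * operatorTensor x' y' = operatorTensor (x * x') (y * y') :=
  hilbertTensor_hom_ext fun ξ η => by simp only [mul_apply_eq_comp, operatorTensor_hilbertTmul]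

theorem operatorTensor_one : operatorTensor (1 : H →L[ℂ] H) (1 : K →L[ℂ] K) = 1 :=
  hilbertTensor_hom_ext fun ξ η => by simp only [one_apply_eq_self, operatorTensor_hilbertTmul]

theorem operatorTensor_neg_left (x : H →L[ℂ] H) (y : K →L[ℂ] K) :
    operatorTensor (-x) y = -operatorTensor x y :=
  hilbertTensor_hom_ext fun ξ η => by
    simp only [_root_.neg_apply, operatorTensor_hilbertTmul, map_neg]

theorem operatorTensor_add_right (x : H →L[ℂ] H) (y y' : K →L[ℂ] K) :
    operatorTensor x (y + y') = operatorTensor x y + operatorTensor x y' :=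
  hilbertTensor_hom_ext fun ξ η => by
    simp only [_root_.add_apply, operatorTensor_hilbertTmul, map_add]

theorem operatorTensor_smul_right (c : ℂ) (x : H →L[ℂ] H) (y : K →L[ℂ] K) :
    operatorTensor x (c • y) = c • operatorTensor x y :=
  hilbertTensor_hom_ext fun ξ η => by
    simp only [_root_.smul_apply, operatorTensor_hilbertTmul, map_smul]

theorem commute_operatorTensor {x x' : H →L[ℂ] H} {y y' : K →L[ℂ] K} (hx : Commute x x')
    (hy : Commute y y') : Commute (operatorTensor x y) (operatorTensor x' y') := by
  rw [commute_iff_eq, operatorTensor_mul, operatorTensor_mul, hx.eq, hy.eq]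

variable [CompleteSpace H] [CompleteSpace K]

theorem star_operatorTensor (x : H →L[ℂ] H) (y : K →L[ℂ] K) :
    star (operatorTensor x y) = operatorTensor (star x) (star y) := by
  refine hilbertTensor_hom_ext fun ξ η => ext_inner_right ℂ fun z => ?_
  have hfunctional : innerSL ℂ (hilbertTmul ξ η) ∘L operatorTensor x y
      = innerSL ℂ (hilbertTmul (star x ξ) (star y η)) :=
    hilbertTensor_hom_ext fun ξ' η' => by
      simp only [ContinuousLinearMap.comp_apply, innerSL_apply_apply, operatorTensor_hilbertTmul,
        inner_hilbertTmul, ContinuousLinearMap.star_eq_adjoint,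
        ContinuousLinearMap.adjoint_inner_left]
  rw [ContinuousLinearMap.star_eq_adjoint, ContinuousLinearMap.adjoint_inner_left,
    operatorTensor_hilbertTmul]
  exact DFunLike.congr_fun hfunctional z

variable (H) in
/-- The representation `y ↦ 1 ⊗ y`. -/
noncomputable def oneTensor : (K →L[ℂ] K) →⋆ₐ[ℂ] (HilbertTensor H K →L[ℂ] HilbertTensor H K) where
  toFun y := operatorTensor 1 y
  map_one' := operatorTensor_one
  map_mul' y y' := by rw [operatorTensor_mul, one_mul]
  map_zero' := by simpa using operatorTensor_smul_right (0 : ℂ) (1 : H →L[ℂ] H) (0 : K →L[ℂ] K)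
  map_add' := operatorTensor_add_right 1
  commutes' r := by
    rw [Algebra.algebraMap_eq_smul_one, Algebra.algebraMap_eq_smul_one, operatorTensor_smul_right,
      operatorTensor_one]
  map_star' y := by rw [star_operatorTensor, star_one]

end OperatorTensor

section TensorSubspace

variable {H : Type u} [NormedAddCommGroup H] [InnerProductSpace ℂ H]
  {K : Type v} [NormedAddCommGroup K] [InnerProductSpace ℂ K]

/-- The span of the elementary tensors `ξ ⊗ η` with `ξ ∈ V`. -/
noncomputable def tensorSubspace (V : Submodule ℂ H) (K : Type v) [NormedAddCommGroup K]
    [InnerProductSpace ℂ K] : Submodule ℂ (HilbertTensor H K) :=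
  Submodule.span ℂ {z | ∃ ξ ∈ V, ∃ η : K, hilbertTmul ξ η = z}

theorem hilbertTmul_mem_tensorSubspace {V : Submodule ℂ H} {ξ : H} (hξ : ξ ∈ V) (η : K) :
    hilbertTmul ξ η ∈ tensorSubspace V K :=
  Submodule.subset_span ⟨ξ, hξ, η, rfl⟩

theorem tensorSubspace_le {V : Submodule ℂ H} {L : Submodule ℂ (HilbertTensor H K)} :
    tensorSubspace V K ≤ L ↔ ∀ ξ ∈ V, ∀ η, hilbertTmul ξ η ∈ L := by
  refine Submodule.span_le.trans ⟨fun h ξ hξ η => h ⟨ξ, hξ, η, rfl⟩, ?_⟩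
  rintro h _ ⟨ξ, hξ, η, rfl⟩
  exact h ξ hξ η

theorem tensorSubspace_mono {V V' : Submodule ℂ H} (h : V ≤ V') :
    tensorSubspace V K ≤ tensorSubspace V' K :=
  tensorSubspace_le.2 fun _ hξ η => hilbertTmul_mem_tensorSubspace (h hξ) η

theorem operatorTensor_apply_mem_tensorSubspace {V : Submodule ℂ H} {x : H →L[ℂ] H}
    (hx : ∀ ξ ∈ V, x ξ ∈ V) (y : K →L[ℂ] K) {z : HilbertTensor H K}
    (hz : z ∈ tensorSubspace V K) : operatorTensor x y z ∈ tensorSubspace V K := by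
  have hle : tensorSubspace V K ≤ (tensorSubspace V K).comap (operatorTensor x y).toLinearMap :=
    tensorSubspace_le.2 fun ξ hξ η => by
      change operatorTensor x y (hilbertTmul ξ η) ∈ tensorSubspace V K
      rw [operatorTensor_hilbertTmul]
      exact hilbertTmul_mem_tensorSubspace (hx ξ hξ) _
  exact hle hz

theorem inner_operatorTensor_apply_eq_zero {V : Submodule ℂ H} {x : H →L[ℂ] H}
    (hx : ∀ ξ ∈ V, ∀ ξ' ∈ V, inner ℂ ξ (x ξ') = 0) {z w : HilbertTensor H K}
    (hz : z ∈ tensorSubspace V K) (hw : w ∈ tensorSubspace V K) :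
    inner ℂ z (operatorTensor x 1 w) = 0 := by
  induction hz, hw using Submodule.span_induction₂ with
  | zero_left _ _ => exact inner_zero_left _
  | zero_right _ _ => rw [map_zero, inner_zero_right]
  | add_left _ _ _ _ _ _ ha hb => rw [inner_add_left, ha, hb, add_zero]
  | add_right _ _ _ _ _ _ ha hb => rw [map_add, inner_add_right, ha, hb, add_zero]
  | smul_left _ _ _ _ _ ha => rw [inner_smul_left, ha, mul_zero]
  | smul_right _ _ _ _ _ ha => rw [map_smul, inner_smul_right, ha, mul_zero]
  | mem_mem _ _ hz hw =>
    obtain ⟨ξ, hξ, η, rfl⟩ := hz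
    obtain ⟨ξ', hξ', η', rfl⟩ := hw
    rw [operatorTensor_hilbertTmul, inner_hilbertTmul, hx ξ hξ ξ' hξ', zero_mul]

theorem dense_iUnion_tensorSubspace {V : ℕ → Submodule ℂ H} (hV : Monotone V)
    (hd : Dense (⋃ s, (V s : Set H))) :
    Dense (⋃ s, (tensorSubspace (V s) K : Set (HilbertTensor H K))) := by
  rw [dense_iUnion_coe_iff fun _ _ h => tensorSubspace_mono (hV h)]
  refine eq_top_of_hilbertTmul_mem (Submodule.isClosed_topologicalClosure _) fun ξ η => ?_
  refine map_mem_closure (f := fun ξ => hilbertTmul ξ η) (hilbertTmul.flip η).continuous (hd ξ)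
    fun ξ' hξ' => ?_
  obtain ⟨s, hs⟩ := Set.mem_iUnion.1 hξ'
  exact Submodule.mem_iSup_of_mem s (hilbertTmul_mem_tensorSubspace hs η)

end TensorSubspace

namespace PauliSystem

variable {H : Type u} [NormedAddCommGroup H] [InnerProductSpace ℂ H] [CompleteSpace H]
  (P : PauliSystem H)

/-- The Pauli system `X ⊗ 1`, `Z ⊗ 1` on a tensor product. -/
noncomputable def tensor (K : Type v) [NormedAddCommGroup K] [InnerProductSpace ℂ K]
    [CompleteSpace K] : PauliSystem (HilbertTensor H K) where
  X i := operatorTensor (P.X i) 1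
  Z i := operatorTensor (P.Z i) 1
  star_X i := by rw [star_operatorTensor, P.star_X, star_one]
  star_Z i := by rw [star_operatorTensor, P.star_Z, star_one]
  X_mul_X i := by rw [operatorTensor_mul, P.X_mul_X, one_mul, operatorTensor_one]
  Z_mul_Z i := by rw [operatorTensor_mul, P.Z_mul_Z, one_mul, operatorTensor_one]
  X_mul_Z i := by rw [operatorTensor_mul, operatorTensor_mul, P.X_mul_Z, operatorTensor_neg_left]
  commute_XX i j := commute_operatorTensor (P.commute_XX i j) (.one_right _)
  commute_ZZ i j := commute_operatorTensor (P.commute_ZZ i j) (.one_right _)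
  commute_XZ i j h := commute_operatorTensor (P.commute_XZ i j h) (.one_right _)
  V s := tensorSubspace (P.V s) K
  mono _ _ h := tensorSubspace_mono (P.mono h)
  dense := dense_iUnion_tensorSubspace P.mono P.dense
  X_mem i s h _ := operatorTensor_apply_mem_tensorSubspace (P.X_mem i s h) 1
  Z_mem i s h _ := operatorTensor_apply_mem_tensorSubspace (P.Z_mem i s h) 1
  inner_X s _ hf _ hg := inner_operatorTensor_apply_eq_zero (P.inner_X s) hf hg
  inner_Z s _ hf _ hg := inner_operatorTensor_apply_eq_zero (P.inner_Z s) hf hg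
  inner_XZ s _ hf _ hg := by
    rw [← mul_apply_eq_comp, operatorTensor_mul, one_mul]
    exact inner_operatorTensor_apply_eq_zero (x := P.X s * P.Z s) (P.inner_XZ s) hf hg

variable {K : Type v} [NormedAddCommGroup K] [InnerProductSpace ℂ K] [CompleteSpace K]
  {E : Type*} [CStarAlgebra E] (π : E →⋆ₐ[ℂ] (K →L[ℂ] K))

/-- The Pauli system `X ⊗ 1`, `Z ⊗ 1` together with the representation `1 ⊗ π`. -/
noncomputable def tensorRep : PauliRep E (HilbertTensor H K) where
  __ := P.tensor K
  π := (oneTensor H).comp π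
  commutesWithFactor _ _ :=
    ⟨commute_operatorTensor (.one_left _) (.one_right _),
      commute_operatorTensor (.one_left _) (.one_right _)⟩
  π_mem x _ _ := operatorTensor_apply_mem_tensorSubspace (fun _ hξ => hξ) (π x)

theorem isCyclicVector_tensorRep {Ω : H} (hΩ : IsCyclicVector (Set.range P.X ∪ Set.range P.Z) Ω)
    {η : K} (hη : DenseRange fun x => π x η) :
    IsCyclicVector (P.tensorRep π).generators (hilbertTmul Ω η) := by
  intro L hL hmem hinv
  refine eq_top_of_hilbertTmul_mem hL fun ξ ζ => ?_
  have hΩζ : hilbertTmul Ω ζ ∈ L := by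
    refine hL.closure_subset (map_mem_closure (hilbertTmul Ω).continuous (hη ζ) ?_)
    rintro _ ⟨x, rfl⟩
    have hπ := hinv _ (.inr ⟨x, rfl⟩) _ hmem
    exact operatorTensor_hilbertTmul 1 (π x) Ω η ▸ hπ
  have htop : L.comap (hilbertTmul.flip ζ).toLinearMap = ⊤ := by
    refine hΩ _ (hL.preimage (hilbertTmul.flip ζ).continuous) hΩζ ?_
    rintro _ (⟨i, rfl⟩ | ⟨i, rfl⟩) ξ hξ
    · have hX : operatorTensor (P.X i) 1 (hilbertTmul ξ ζ) ∈ L :=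
        hinv _ (.inl (.inl ⟨i, rfl⟩)) _ hξ
      rwa [operatorTensor_hilbertTmul] at hX
    · have hZ : operatorTensor (P.Z i) 1 (hilbertTmul ξ ζ) ∈ L :=
        hinv _ (.inl (.inr ⟨i, rfl⟩)) _ hξ
      rwa [operatorTensor_hilbertTmul] at hZ
  exact htop.ge (Submodule.mem_top (x := ξ))

end PauliSystem

section WeightedPermutation

variable {ι : Type} {e : Equiv.Perm ι} {c : ι → ℂ} {hc : ∀ i, ‖c i‖ = 1}

theorem star_weightedPermutation_of_mul_self
    (h : weightedPermutation e c hc * weightedPermutation e c hc = 1) :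
    star (weightedPermutation e c hc) = weightedPermutation e c hc := by
  set U := weightedPermutation e c hc with hU
  have hisometry : star U * U = 1 := by
    rw [ContinuousLinearMap.star_eq_adjoint]
    refine (ContinuousLinearMap.norm_map_iff_adjoint_comp_self U).1 fun f => ?_
    rw [hU, weightedPermutation, LinearIsometry.coe_toContinuousLinearMap, LinearIsometry.norm_map]
  calc star U = star U * (U * U) := by rw [h, mul_one]
    _ = U := by rw [← mul_assoc, hisometry, one_mul]

end WeightedPermutation

section PauliSpace

theorem pauliX_apply (j : ℕ) (f : PauliSpace) (p : Finset ℕ × Finset ℕ) :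
    pauliX j f p = f (p.1 ∆ {j}, p.2) :=
  one_mul _

theorem pauliZ_apply (j : ℕ) (f : PauliSpace) (p : Finset ℕ × Finset ℕ) :
    pauliZ j f p = (if j ∈ p.1 then -1 else 1) * f (p.1, p.2 ∆ {j}) := rfl

theorem pauliX_mul_self (j : ℕ) : pauliX j * pauliX j = 1 := by
  ext f p
  simp [pauliX_apply]

theorem pauliZ_mul_self (j : ℕ) : pauliZ j * pauliZ j = 1 := by
  ext f p
  simp only [mul_apply_eq_comp, pauliZ_apply, symmDiff_symmDiff_cancel_right, one_apply_eq_self]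
  split_ifs <;> simp

theorem pauliX_single (j : ℕ) (p : Finset ℕ × Finset ℕ) :
    pauliX j (lp.single 2 p (1 : ℂ)) = lp.single 2 (p.1 ∆ {j}, p.2) (1 : ℂ) := by
  ext q
  have hiff : (q.1 ∆ {j}, q.2) = p ↔ q = (p.1 ∆ {j}, p.2) := by
    constructor <;> rintro rfl <;> simp
  simp only [pauliX_apply, lp.single_apply, Pi.single_apply, hiff]

theorem pauliZ_single (j : ℕ) (p : Finset ℕ × Finset ℕ) :
    pauliZ j (lp.single 2 p (1 : ℂ)) =
      (if j ∈ p.1 then -1 else 1 : ℂ) • lp.single 2 (p.1, p.2 ∆ {j}) (1 : ℂ) := by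
  ext q
  have hiff : (q.1, q.2 ∆ {j}) = p ↔ q = (p.1, p.2 ∆ {j}) := by
    constructor <;> rintro rfl <;> simp
  simp only [pauliZ_apply, lp.coeFn_smul, Pi.smul_apply, lp.single_apply, Pi.single_apply, hiff,
    smul_eq_mul]
  split_ifs with h <;> simp_all

theorem symmDiff_singleton_subset_range {i s : ℕ} (h : i < s) {S : Finset ℕ} :
    S ∆ {i} ⊆ Finset.range s ↔ S ⊆ Finset.range s := by
  simp only [Finset.subset_iff, Finset.mem_symmDiff, Finset.mem_singleton, Finset.mem_range]
  grind

theorem not_symmDiff_singleton_subset_range {s : ℕ} {S : Finset ℕ}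
    (hS : S ⊆ Finset.range s) : ¬ S ∆ {s} ⊆ Finset.range s := by
  intro h
  have hs : s ∉ S := fun hs => by simpa using hS hs
  simpa [Finset.mem_symmDiff, hs] using @h s

theorem symmDiff_singleton_eq_insert {S : Finset ℕ} {a : ℕ} (ha : a ∉ S) :
    S ∆ {a} = insert a S := by
  rw [(Finset.disjoint_singleton_right.2 ha).symmDiff_eq_sup, Finset.sup_eq_union,
    Finset.union_comm, Finset.insert_eq]

/-- The closed span of the Pauli monomials in the first `s` tensor factors. -/
def pauliSubspace (s : ℕ) : Submodule ℂ PauliSpace where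
  carrier := {f | ∀ p, ¬ (p.1 ⊆ Finset.range s ∧ p.2 ⊆ Finset.range s) → f p = 0}
  zero_mem' _ _ := rfl
  add_mem' {f g} hf hg p hp := by simp [hf p hp, hg p hp]
  smul_mem' c f hf p hp := by simp [hf p hp]

theorem single_mem_pauliSubspace {s : ℕ} {p : Finset ℕ × Finset ℕ} (h₁ : p.1 ⊆ Finset.range s)
    (h₂ : p.2 ⊆ Finset.range s) (c : ℂ) : (lp.single 2 p c : PauliSpace) ∈ pauliSubspace s := by
  refine fun q hq => lp.single_apply_ne (E := fun _ => ℂ) 2 p c ?_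
  rintro rfl
  exact hq ⟨h₁, h₂⟩

theorem pauliSubspace_mono : Monotone pauliSubspace := fun _ _ h _ hf p hp =>
  hf p fun hp' => hp ⟨hp'.1.trans (Finset.range_mono h), hp'.2.trans (Finset.range_mono h)⟩

theorem eq_top_of_single_mem {ι : Type*} [DecidableEq ι] {L : Submodule ℂ (lp (fun _ : ι => ℂ) 2)}
    (hL : IsClosed (L : Set (lp (fun _ : ι => ℂ) 2))) (h : ∀ p, lp.single 2 p (1 : ℂ) ∈ L) :
    L = ⊤ := by
  refine eq_top_iff.2 fun f _ => hL.mem_of_tendsto (lp.hasSum_single (by norm_num) f)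
    (.of_forall fun t => L.sum_mem fun p _ => ?_)
  rw [← mul_one (f p), ← smul_eq_mul, lp.single_smul]
  exact L.smul_mem _ (h p)

theorem dense_iUnion_pauliSubspace : Dense (⋃ s, (pauliSubspace s : Set PauliSpace)) := by
  rw [dense_iUnion_coe_iff pauliSubspace_mono]
  refine eq_top_of_single_mem (Submodule.isClosed_topologicalClosure _) fun p => ?_
  have hrange {S : Finset ℕ} (hS : S ⊆ p.1 ∪ p.2) :
      S ⊆ Finset.range ((p.1 ∪ p.2).sup id + 1) := fun a ha =>
    Finset.mem_range_succ_iff.2 (Finset.le_sup (f := id) (hS ha))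
  exact subset_closure (Submodule.mem_iSup_of_mem _ (single_mem_pauliSubspace
    (hrange Finset.subset_union_left) (hrange Finset.subset_union_right) 1))

theorem pauliX_mem_pauliSubspace {i s : ℕ} (h : i < s) {f : PauliSpace}
    (hf : f ∈ pauliSubspace s) : pauliX i f ∈ pauliSubspace s := fun p hp => by
  rw [pauliX_apply]
  exact hf _ (by rwa [symmDiff_singleton_subset_range h])

theorem pauliZ_mem_pauliSubspace {i s : ℕ} (h : i < s) {f : PauliSpace}
    (hf : f ∈ pauliSubspace s) : pauliZ i f ∈ pauliSubspace s := fun p hp => by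
  rw [pauliZ_apply, hf _ (by rwa [symmDiff_singleton_subset_range h]), mul_zero]

theorem inner_eq_zero_of_mem_pauliSubspace {s : ℕ} {f g : PauliSpace} (hf : f ∈ pauliSubspace s)
    (hg : ∀ p : Finset ℕ × Finset ℕ, p.1 ⊆ Finset.range s → p.2 ⊆ Finset.range s → g p = 0) :
    inner ℂ f g = 0 := by
  rw [lp.inner_eq_tsum]
  refine (tsum_congr fun p => ?_).trans tsum_zero
  by_cases hp : p.1 ⊆ Finset.range s ∧ p.2 ⊆ Finset.range s
  · rw [hg p hp.1 hp.2, inner_zero_right]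
  · rw [hf p hp, inner_zero_left]

/-- The Pauli operators on the space `L²(⨂_ℕ M₂(ℂ), tr)`. -/
noncomputable def pauliSystem : PauliSystem PauliSpace where
  X := pauliX
  Z := pauliZ
  star_X i := star_weightedPermutation_of_mul_self (pauliX_mul_self i)
  star_Z i := star_weightedPermutation_of_mul_self (pauliZ_mul_self i)
  X_mul_X := pauliX_mul_self
  Z_mul_Z := pauliZ_mul_self
  X_mul_Z i := by
    ext f p
    simp only [mul_apply_eq_comp, pauliZ_apply, pauliX_apply, _root_.neg_apply, lp.coeFn_neg,
      Pi.neg_apply]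
    by_cases h : i ∈ p.1 <;> simp [h, Finset.mem_symmDiff]
  commute_XX i j := by
    ext f p
    simp only [mul_apply_eq_comp, pauliX_apply, symmDiff_right_comm]
  commute_ZZ i j := by
    ext f p
    simp only [mul_apply_eq_comp, pauliZ_apply, symmDiff_right_comm]
    ring
  commute_XZ i j h := by
    ext f p
    have hmem : j ∈ p.1 ∆ {i} ↔ j ∈ p.1 := by simp [Finset.mem_symmDiff, h.symm]
    simp only [mul_apply_eq_comp, pauliZ_apply, pauliX_apply, hmem]
  V := pauliSubspace
  mono := pauliSubspace_mono
  dense := dense_iUnion_pauliSubspace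
  X_mem _ _ h _ := pauliX_mem_pauliSubspace h
  Z_mem _ _ h _ := pauliZ_mem_pauliSubspace h
  inner_X s f hf g hg := inner_eq_zero_of_mem_pauliSubspace hf fun p hp _ => by
    rw [pauliX_apply, hg _ fun h => not_symmDiff_singleton_subset_range hp h.1]
  inner_Z s f hf g hg := inner_eq_zero_of_mem_pauliSubspace hf fun p _ hp => by
    rw [pauliZ_apply, hg _ fun h => not_symmDiff_singleton_subset_range hp h.2, mul_zero]
  inner_XZ s f hf g hg := inner_eq_zero_of_mem_pauliSubspace hf fun p hp _ => by
    rw [pauliX_apply, pauliZ_apply, hg _ fun h => not_symmDiff_singleton_subset_range hp h.1,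
      mul_zero]

/-- The trace vector of `PauliSpace`, corresponding to the unit of `⨂_ℕ M₂(ℂ)`. -/
noncomputable def pauliVector : PauliSpace := lp.single 2 (∅, ∅) 1

theorem norm_pauliVector : ‖pauliVector‖ = 1 := by
  rw [pauliVector, lp.norm_single (by norm_num), norm_one]

theorem pauliVector_mem : pauliVector ∈ pauliSystem.V 0 :=
  single_mem_pauliSubspace (Finset.empty_subset _) (Finset.empty_subset _) 1

theorem isCyclicVector_pauliVector :
    IsCyclicVector (Set.range pauliX ∪ Set.range pauliZ) pauliVector := by
  refine fun L hL hΩ hinv => eq_top_of_single_mem hL fun ⟨S, U⟩ => ?_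
  induction S using Finset.induction_on with
  | empty =>
    induction U using Finset.induction_on with
    | empty => exact hΩ
    | insert a U ha ih =>
      have hmem := hinv _ (.inr ⟨a, rfl⟩) _ ih
      rw [pauliZ_single, symmDiff_singleton_eq_insert ha, if_neg (Finset.notMem_empty a),
        one_smul] at hmem
      exact hmem
  | insert a S ha ih =>
    have hmem := hinv _ (.inl ⟨a, rfl⟩) _ ih
    rwa [pauliX_single, symmDiff_singleton_eq_insert ha] at hmem

end PauliSpace

theorem image_centralizer {F M N : Type*} [Mul M] [Mul N] [EquivLike F M N] [MulEquivClass F M N]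
    (e : F) (S : Set M) : e '' S.centralizer = (e '' S).centralizer := by
  ext y
  obtain ⟨x, rfl⟩ := EquivLike.surjective e y
  rw [(EquivLike.injective e).mem_set_image, Set.mem_centralizer_iff, Set.mem_centralizer_iff,
    Set.forall_mem_image]
  simp only [← map_mul, (EquivLike.injective e).eq_iff]

section Generated

variable {H : Type u} [NormedAddCommGroup H] [InnerProductSpace ℂ H] [CompleteSpace H]
variable {K : Type v} [NormedAddCommGroup K] [InnerProductSpace ℂ K] [CompleteSpace K]

theorem coe_vonNeumannAlgebraGenerated (S : Set (H →L[ℂ] H)) :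
    (vonNeumannAlgebraGenerated S : Set (H →L[ℂ] H)) = (S ∪ star S).centralizer.centralizer :=
  StarSubalgebra.coe_centralizer_centralizer ℂ S

theorem subset_vonNeumannAlgebraGenerated (S : Set (H →L[ℂ] H)) :
    S ⊆ vonNeumannAlgebraGenerated S := by
  rw [coe_vonNeumannAlgebraGenerated]
  exact Set.subset_union_left.trans Set.subset_centralizer_centralizer

theorem vonNeumannAlgebraGenerated_le {S : Set (H →L[ℂ] H)} {N : VonNeumannAlgebra H} :
    vonNeumannAlgebraGenerated S ≤ N ↔ S ⊆ N := by
  refine ⟨(subset_vonNeumannAlgebraGenerated S).trans, fun h => ?_⟩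
  have hunion : S ∪ star S ⊆ N := Set.union_subset h fun s hs => star_star s ▸ star_mem (h hs)
  rw [← SetLike.coe_subset_coe, coe_vonNeumannAlgebraGenerated, ← N.centralizer_centralizer]
  exact Set.centralizer_subset (Set.centralizer_subset hunion)

theorem vonNeumannAlgebraGenerated_mono {S S' : Set (H →L[ℂ] H)} (h : S ⊆ S') :
    vonNeumannAlgebraGenerated S ≤ vonNeumannAlgebraGenerated S' :=
  vonNeumannAlgebraGenerated_le.2 (h.trans (subset_vonNeumannAlgebraGenerated S'))

theorem vonNeumannAlgebraGenerated_congr {S S' : Set (H →L[ℂ] H)} (hS : star S = S)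
    (hS' : star S' = S') (h : S.centralizer = S'.centralizer) :
    vonNeumannAlgebraGenerated S = vonNeumannAlgebraGenerated S' :=
  SetLike.coe_injective <| by
    rw [coe_vonNeumannAlgebraGenerated, coe_vonNeumannAlgebraGenerated, hS, hS', Set.union_self,
      Set.union_self, h]

theorem image_conj_vonNeumannAlgebraGenerated (e : H ≃ₗᵢ[ℂ] K) (S : Set (H →L[ℂ] H)) :
    e.conjStarAlgEquiv '' vonNeumannAlgebraGenerated S =
      vonNeumannAlgebraGenerated (e.conjStarAlgEquiv '' S) := by
  have himage_star : e.conjStarAlgEquiv '' star S = star (e.conjStarAlgEquiv '' S) := by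
    rw [← Set.image_star, ← Set.image_star, Set.image_image, Set.image_image]
    simp only [map_star]
  rw [coe_vonNeumannAlgebraGenerated, coe_vonNeumannAlgebraGenerated, image_centralizer,
    image_centralizer, Set.image_union, himage_star]

theorem isomorphic_vonNeumannAlgebraGenerated_image_conj (e : H ≃ₗᵢ[ℂ] K) (S : Set (H →L[ℂ] H)) :
    (vonNeumannAlgebraGenerated S).Isomorphic
      (vonNeumannAlgebraGenerated (e.conjStarAlgEquiv '' S)) := by
  have himage := image_conj_vonNeumannAlgebraGenerated e S
  let F : (vonNeumannAlgebraGenerated S).toStarSubalgebra →⋆ₐ[ℂ]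
      (vonNeumannAlgebraGenerated (e.conjStarAlgEquiv '' S)).toStarSubalgebra :=
    StarAlgHom.codRestrict (e.conjStarAlgEquiv.toStarAlgHom.comp (StarSubalgebra.subtype _)) _
      fun T => himage.subset ⟨T, T.2, rfl⟩
  refine ⟨StarAlgEquiv.ofBijective F ⟨fun x y h => ?_, fun y => ?_⟩⟩
  · exact Subtype.ext (e.conjStarAlgEquiv.injective (congrArg Subtype.val h))
  · obtain ⟨T, hT, hTy⟩ := himage.superset y.2
    exact ⟨⟨T, hT⟩, Subtype.ext hTy⟩

end Generated

section Amplification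

variable {H : Type u} [NormedAddCommGroup H] [InnerProductSpace ℂ H] [CompleteSpace H]
  {G : Type v} [NormedAddCommGroup G] [InnerProductSpace ℂ G] [CompleteSpace G]

/-- The map `ρ` from `B(H)` to `B(G)` is an amplification along the operators `V i` from `H` to `G`:
it preserves adjoints, every `V i` intertwines `a` and `ρ a`, and the ranges of the `V i` span a
dense subspace. -/
structure IsAmplification {ι : Type*} (V : ι → H →L[ℂ] G) (ρ : (H →L[ℂ] H) → (G →L[ℂ] G)) :
    Prop where
  star_map : ∀ a, star (ρ a) = ρ (star a)
  map_apply : ∀ i a ξ, ρ a (V i ξ) = V i (a ξ)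
  eq_top : ∀ L : Submodule ℂ G, IsClosed (L : Set G) → (∀ i ξ, V i ξ ∈ L) → L = ⊤

namespace IsAmplification

variable {ι : Type*} {V : ι → H →L[ℂ] G} {ρ : (H →L[ℂ] H) → (G →L[ℂ] G)}

theorem adjoint_map_apply (h : IsAmplification V ρ) (i : ι) (a : H →L[ℂ] H) (z : G) :
    (V i).adjoint (ρ a z) = a ((V i).adjoint z) := by
  refine ext_inner_left ℂ fun ξ => ?_
  rw [ContinuousLinearMap.adjoint_inner_right, ← ContinuousLinearMap.adjoint_inner_left,
    ← ContinuousLinearMap.star_eq_adjoint, h.star_map, h.map_apply,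
    ← ContinuousLinearMap.adjoint_inner_left, ContinuousLinearMap.adjoint_inner_right,
    ContinuousLinearMap.star_eq_adjoint]

theorem eq_zero_of_adjoint_apply_eq_zero (h : IsAmplification V ρ) {z : G}
    (hz : ∀ i, (V i).adjoint z = 0) : z = 0 := by
  have htop : LinearMap.ker (innerSL ℂ z).toLinearMap = ⊤ :=
    h.eq_top _ (ContinuousLinearMap.isClosed_ker _) fun i ξ => by
      change inner ℂ z (V i ξ) = 0
      rw [← ContinuousLinearMap.adjoint_inner_left, hz, inner_zero_left]
  exact inner_self_eq_zero.1 (htop.ge (Submodule.mem_top (x := z)))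

theorem hom_ext (h : IsAmplification V ρ) {S T : G →L[ℂ] G}
    (hST : ∀ i ξ, S (V i ξ) = T (V i ξ)) : S = T :=
  ContinuousLinearMap.coe_injective <| LinearMap.eqLocus_eq_top.1 <|
    h.eq_top _ (isClosed_eq S.continuous T.continuous) hST

theorem commute_map_iff (h : IsAmplification V ρ) {T : G →L[ℂ] G} {a : H →L[ℂ] H} :
    Commute T (ρ a) ↔ ∀ i j, Commute ((V i).adjoint ∘L T ∘L V j) a := by
  simp only [commute_iff_eq, ContinuousLinearMap.ext_iff, mul_apply_eq_comp,
    ContinuousLinearMap.comp_apply]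
  refine ⟨fun hT i j ξ => ?_, fun hT => ?_⟩
  · rw [← h.map_apply, hT, h.adjoint_map_apply]
  · refine fun z => DFunLike.congr_fun (h.hom_ext (S := T * ρ a) (T := ρ a * T) fun j ξ => ?_) z
    refine sub_eq_zero.1 (h.eq_zero_of_adjoint_apply_eq_zero fun i => ?_)
    rw [map_sub, mul_apply_eq_comp, mul_apply_eq_comp, h.map_apply, h.adjoint_map_apply, hT,
      sub_self]

theorem map_mem_vonNeumannAlgebraGenerated (h : IsAmplification V ρ) {S : Set (H →L[ℂ] H)}
    {a : H →L[ℂ] H} (ha : a ∈ vonNeumannAlgebraGenerated S) :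
    ρ a ∈ vonNeumannAlgebraGenerated (ρ '' S) := by
  rw [← SetLike.mem_coe, coe_vonNeumannAlgebraGenerated] at ha ⊢
  refine fun T hT => h.commute_map_iff.2 fun i j => ha _ fun s hs => ?_
  refine (h.commute_map_iff.1 (Commute.symm (hT (ρ s) ?_)) i j).symm
  rcases hs with hs | hs
  · exact .inl ⟨s, hs, rfl⟩
  · exact .inr ⟨star s, hs, by rw [h.star_map]⟩

end IsAmplification

end Amplification

section Tensor

variable {H : Type u} [NormedAddCommGroup H] [InnerProductSpace ℂ H] [CompleteSpace H]
variable {K : Type v} [NormedAddCommGroup K] [InnerProductSpace ℂ K] [CompleteSpace K]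

variable (H K) in
theorem isAmplification_operatorTensor_one :
    IsAmplification (G := HilbertTensor H K) (fun η => hilbertTmul.flip η)
      fun x : H →L[ℂ] H => operatorTensor x 1 where
  star_map x := by rw [star_operatorTensor, star_one]
  map_apply η x ξ := operatorTensor_hilbertTmul x 1 ξ η
  eq_top _ hL h := eq_top_of_hilbertTmul_mem hL fun ξ η => h η ξ

variable (H K) in
theorem isAmplification_one_operatorTensor :
    IsAmplification (G := HilbertTensor H K) (fun ξ => hilbertTmul ξ)
      fun y : K →L[ℂ] K => operatorTensor 1 y where
  star_map y := by rw [star_operatorTensor, star_one]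
  map_apply ξ y η := operatorTensor_hilbertTmul 1 y ξ η
  eq_top _ hL h := eq_top_of_hilbertTmul_mem hL h

theorem tensor_vonNeumannAlgebraGenerated (S : Set (H →L[ℂ] H)) (S' : Set (K →L[ℂ] K)) :
    (vonNeumannAlgebraGenerated S).tensor (vonNeumannAlgebraGenerated S') =
      vonNeumannAlgebraGenerated
        ((fun x => operatorTensor x 1) '' S ∪ (fun y => operatorTensor 1 y) '' S') := by
  refine le_antisymm (vonNeumannAlgebraGenerated_le.2 ?_) (vonNeumannAlgebraGenerated_le.2 ?_)
  · rintro _ ⟨x, hx, y, hy, rfl⟩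
    rw [← one_mul y, ← mul_one x, ← operatorTensor_mul]
    exact mul_mem
      (vonNeumannAlgebraGenerated_mono Set.subset_union_left
        ((isAmplification_operatorTensor_one H K).map_mem_vonNeumannAlgebraGenerated hx))
      (vonNeumannAlgebraGenerated_mono Set.subset_union_right
        ((isAmplification_one_operatorTensor H K).map_mem_vonNeumannAlgebraGenerated hy))
  · rintro _ (⟨x, hx, rfl⟩ | ⟨y, hy, rfl⟩) <;> refine subset_vonNeumannAlgebraGenerated _ ?_
    · exact ⟨x, subset_vonNeumannAlgebraGenerated S hx, 1, one_mem _, rfl⟩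
    · exact ⟨1, one_mem _, y, subset_vonNeumannAlgebraGenerated S' hy, rfl⟩

end Tensor

section GNS

variable {A : Type*} [Ring A] [StarRing A] [Algebra ℂ A]
  {H : Type*} [NormedAddCommGroup H] [InnerProductSpace ℂ H] [CompleteSpace H]
  {K : Type*} [NormedAddCommGroup K] [InnerProductSpace ℂ K] [CompleteSpace K]

theorem inner_starAlgHom_apply_apply (ρ : A →⋆ₐ[ℂ] (H →L[ℂ] H)) (Ω : H) (a b : A) :
    inner ℂ (ρ a Ω) (ρ b Ω) = inner ℂ Ω (ρ (star a * b) Ω) := by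
  rw [map_mul, map_star, mul_apply_eq_comp, ContinuousLinearMap.star_eq_adjoint,
    ContinuousLinearMap.adjoint_inner_right]

theorem exists_conjStarAlgEquiv_of_inner_eq {ρ : A →⋆ₐ[ℂ] (H →L[ℂ] H)} {Ω : H}
    {σ : A →⋆ₐ[ℂ] (K →L[ℂ] K)} {Ω' : K} (hΩ : DenseRange fun a => ρ a Ω)
    (hΩ' : DenseRange fun a => σ a Ω')
    (h : ∀ a, inner ℂ Ω (ρ a Ω) = inner ℂ Ω' (σ a Ω')) :
    ∃ e : H ≃ₗᵢ[ℂ] K, ∀ a, e.conjStarAlgEquiv (ρ a) = σ a := by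
  let e₁ : A →ₗ[ℂ] H := (ContinuousLinearMap.apply ℂ H Ω).toLinearMap ∘ₗ ρ.toAlgHom.toLinearMap
  let e₂ : A →ₗ[ℂ] K := (ContinuousLinearMap.apply ℂ K Ω').toLinearMap ∘ₗ σ.toAlgHom.toLinearMap
  have hnorm (a : A) : ‖e₂ (LinearEquiv.refl ℂ A a)‖ = ‖e₁ a‖ := by
    change ‖σ a Ω'‖ = ‖ρ a Ω‖
    rw [@norm_eq_sqrt_re_inner ℂ, @norm_eq_sqrt_re_inner ℂ, inner_starAlgHom_apply_apply,
      inner_starAlgHom_apply_apply, h]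
  let e : H ≃ₗᵢ[ℂ] K := (LinearEquiv.refl ℂ A).extendOfIsometry e₁ e₂ hΩ hΩ' hnorm
  have he (a : A) : e (ρ a Ω) = σ a Ω' :=
    LinearEquiv.extendOfIsometry_eq (LinearEquiv.refl ℂ A) e₁ e₂ hΩ hΩ' hnorm a
  refine ⟨e, fun a => ContinuousLinearMap.coeFn_injective <|
    hΩ'.equalizer (ContinuousLinearMap.continuous _) (σ a).continuous <| funext fun b => ?_⟩
  simp only [Function.comp_apply]
  rw [LinearIsometryEquiv.conjStarAlgEquiv_apply_apply, ← he b, e.symm_apply_apply,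
    ← mul_apply_eq_comp, ← map_mul, he, he, map_mul, mul_apply_eq_comp]

end GNS

section GNSVector

variable {A : Type u} [CStarAlgebra A] [PartialOrder A] [StarOrderedRing A] (f : A →ₚ[ℂ] ℂ)

/-- The image of `1` in the GNS space of a positive functional. -/
noncomputable def gnsVector : f.GNS := (f.toPreGNS 1 : f.PreGNS)

theorem gnsStarAlgHom_apply_gnsVector (a : A) :
    f.gnsStarAlgHom a (gnsVector f) = (f.toPreGNS a : f.PreGNS) := by
  have happly : f.gnsStarAlgHom a (gnsVector f) = (f.toPreGNS (a * 1) : f.PreGNS) :=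
    f.gnsNonUnitalStarAlgHom_apply_coe
  rwa [mul_one] at happly

theorem inner_gnsVector (a : A) :
    inner ℂ (gnsVector f) (f.gnsStarAlgHom a (gnsVector f)) = f a := by
  rw [gnsStarAlgHom_apply_gnsVector, gnsVector, UniformSpace.Completion.inner_coe,
    PositiveLinearMap.preGNS_inner_def]
  simp

theorem denseRange_gnsStarAlgHom_apply_gnsVector :
    DenseRange fun a => f.gnsStarAlgHom a (gnsVector f) := by
  simp only [gnsStarAlgHom_apply_gnsVector]
  exact UniformSpace.Completion.denseRange_coe.comp f.toPreGNS.surjective.denseRange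
    (UniformSpace.Completion.continuous_coe _)

end GNSVector

theorem norm_eq_one_of_inner_self_eq_one {H : Type*} [NormedAddCommGroup H]
    [InnerProductSpace ℂ H] {Ω : H} (h : inner ℂ Ω Ω = (1 : ℂ)) : ‖Ω‖ = 1 := by
  rw [@norm_eq_sqrt_re_inner ℂ, h, RCLike.one_re, Real.sqrt_one]

theorem TracialState.norm_gnsVector {A : Type u} [CStarAlgebra A] [PartialOrder A]
    [StarOrderedRing A] (τ : TracialState A) : ‖gnsVector τ.toFunctional‖ = 1 := by
  have hone := inner_gnsVector τ.toFunctional 1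
  rw [_root_.map_one, one_apply_eq_self, τ.map_one] at hone
  exact norm_eq_one_of_inner_self_eq_one hone

section Ideals

variable {V : Type*} [NormedAddCommGroup V] [InnerProductSpace ℂ V]

theorem idempotent_mem_of_norm_sub_lt_one {B : Type*} [NormedRing B] [HasSummableGeomSeries B]
    {I : TwoSidedIdeal B} {p t : B} (hp : p * p = p) (ht : t ∈ I) (hpt : p * t = t)
    (h : ‖p - t‖ < 1) : p ∈ I := by
  have hunit : p * (Units.oneSub (p - t) h : Bˣ) = t := by
    rw [Units.val_oneSub, mul_sub, mul_sub, hpt, mul_one, hp, sub_sub_cancel]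
  rw [(Units.eq_mul_inv_iff_mul_eq _).2 hunit]
  exact I.mul_mem_right _ _ ht

open InnerProductSpace in
theorem one_mem_of_rankOne_mem [FiniteDimensional ℂ V] {J : TwoSidedIdeal (V →L[ℂ] V)} {w : V}
    (hw : ‖w‖ = 1) (h : rankOne ℂ w w ∈ J) : 1 ∈ J := by
  let b := stdOrthonormalBasis ℂ V
  have hsum : (1 : V →L[ℂ] V) =
      ∑ i, rankOne ℂ (b i) w * rankOne ℂ w w * rankOne ℂ w (b i) := by
    ext z
    simp only [_root_.sum_apply, mul_apply_eq_comp, rankOne_apply, inner_smul_right,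
      inner_self_eq_norm_sq_to_K, hw, Complex.coe_algebraMap, Complex.ofReal_one, one_pow, mul_one]
    exact (b.sum_repr' z).symm
  rw [hsum]
  exact sum_mem fun i _ => J.mul_mem_right _ _ (J.mul_mem_left _ _ h)

open InnerProductSpace in
theorem exists_rankOne_mul_mul_rankOne_eq_smul {M : V →L[ℂ] V} {r : ℝ} (hr : 0 ≤ r)
    (h : r < ‖M‖) : ∃ (v w : V) (c : ℝ), ‖v‖ ≤ 1 ∧ ‖w‖ = 1 ∧ r < c ∧
      rankOne ℂ w w * M * rankOne ℂ v w = (c : ℂ) • rankOne ℂ w w := by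
  lift r to NNReal using hr
  obtain ⟨v, hv, hMv⟩ := M.exists_lt_apply_of_lt_opNNNorm h
  have hpos : 0 < ‖M v‖ := r.2.trans_lt hMv
  refine ⟨v, ((‖M v‖⁻¹ : ℝ) : ℂ) • M v, ‖M v‖, hv.le, ?_, hMv, ?_⟩
  · rw [norm_smul, Complex.norm_real, norm_inv, norm_norm, inv_mul_cancel₀ hpos.ne']
  · have hinner : inner ℂ (((‖M v‖⁻¹ : ℝ) : ℂ) • M v) (M v) = (‖M v‖ : ℂ) := by
      rw [inner_smul_left, Complex.conj_ofReal, inner_self_eq_norm_sq_to_K]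
      simp only [Complex.coe_algebraMap]
      rw [← Complex.ofReal_pow, ← Complex.ofReal_mul, pow_two, inv_mul_cancel_left₀ hpos.ne']
    ext z
    simp only [mul_apply_eq_comp, rankOne_apply, map_smul, _root_.smul_apply, hinner, smul_smul]
    congr 1
    ring

open InnerProductSpace in
theorem one_mem_of_norm_sub_map_lt [FiniteDimensional ℂ V] [CompleteSpace V] {B : Type*}
    [CStarAlgebra B] (σ : (V →L[ℂ] V) →⋆ₐ[ℂ] B) {I : TwoSidedIdeal B} {y : B} (hy : y ∈ I)
    {M : V →L[ℂ] V} (h : ‖y - σ M‖ < ‖M‖) : 1 ∈ I := by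
  obtain ⟨v, w, c, hv, hw, hc, hM⟩ := exists_rankOne_mul_mul_rankOne_eq_smul (norm_nonneg _) h
  have hc0 : 0 < c := (norm_nonneg _).trans_lt hc
  set p := rankOne ℂ w w
  set d := rankOne ℂ v w
  have hpp : p * p = p := by
    ext z
    simp only [p, mul_apply_eq_comp, rankOne_apply, inner_smul_right, inner_self_eq_norm_sq_to_K,
      hw, Complex.coe_algebraMap, Complex.ofReal_one, one_pow, mul_one]
  have hp : ‖σ p‖ ≤ 1 := (NonUnitalStarAlgHom.norm_apply_le σ p).trans (by simp [p, hw])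
  have hd : ‖σ d‖ ≤ 1 := (NonUnitalStarAlgHom.norm_apply_le σ d).trans (by simp [d, hw, hv])
  let t : B := σ p * ((c⁻¹ : ℂ) • y) * σ d
  have hsub : σ p - t = (c⁻¹ : ℂ) • (σ p * (σ M - y) * σ d) := by
    have hσ : σ p * σ M * σ d = (c : ℂ) • σ p := by rw [← map_mul, ← map_mul, hM, map_smul]
    rw [mul_sub, sub_mul, hσ, smul_sub, inv_smul_smul₀ (Complex.ofReal_ne_zero.2 hc0.ne')]
    simp only [t, mul_smul_comm, smul_mul_assoc]
  have hnorm : ‖σ p * (σ M - y) * σ d‖ < c := by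
    refine lt_of_le_of_lt ?_ hc
    rw [norm_sub_rev y]
    calc ‖σ p * (σ M - y) * σ d‖ ≤ ‖σ p‖ * ‖σ M - y‖ * ‖σ d‖ :=
          (norm_mul_le _ _).trans (mul_le_mul_of_nonneg_right (norm_mul_le _ _) (norm_nonneg _))
      _ ≤ 1 * ‖σ M - y‖ * 1 := by gcongr
      _ = ‖σ M - y‖ := by ring
  have hpI : σ p ∈ I := by
    refine idempotent_mem_of_norm_sub_lt_one (t := t) ?_ ?_ ?_ ?_
    · rw [← map_mul, hpp]
    · rw [show t = σ p * algebraMap ℂ B (c⁻¹ : ℂ) * y * σ d by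
        simp only [t, Algebra.smul_def, mul_assoc]]
      exact I.mul_mem_right _ _ (I.mul_mem_left _ _ hy)
    · simp only [t, ← mul_assoc, ← map_mul, hpp]
    · rw [hsub, norm_smul, norm_inv, Complex.norm_real, Real.norm_of_nonneg hc0.le,
        inv_mul_lt_one₀ hc0]
      exact hnorm
  rw [← map_one σ, ← TwoSidedIdeal.mem_comap]
  exact one_mem_of_rankOne_mem hw ((TwoSidedIdeal.mem_comap σ).2 hpI)

theorem one_mem_of_norm_sub_map_matrix_lt {n : Type*} [Fintype n] [DecidableEq n] {B : Type*}
    [CStarAlgebra B] (σ : CStarMatrix n n ℂ →⋆ₐ[ℂ] B) {I : TwoSidedIdeal B} {y : B} (hy : y ∈ I)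
    {M : CStarMatrix n n ℂ} (h : ‖y - σ M‖ < ‖M‖) : 1 ∈ I := by
  let e : CStarMatrix n n ℂ ≃⋆ₐ[ℂ] (EuclideanSpace ℂ n →L[ℂ] EuclideanSpace ℂ n) :=
    CStarMatrix.ofMatrixStarAlgEquiv.symm.trans Matrix.toEuclideanCLM
  refine one_mem_of_norm_sub_map_lt (σ.comp e.symm.toStarAlgHom) hy (M := e M) ?_
  rw [NonUnitalStarAlgHom.norm_map e e.injective M]
  exact (congrArg (fun N => ‖y - σ N‖) (e.symm_apply_apply M)).trans_lt h

end Ideals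

theorem exists_forall_mem_dist_lt_of_dense {X : Type*} [PseudoMetricSpace X] {S : ℕ → Set X}
    (hS : Monotone S) (hd : Dense (⋃ m, S m)) (F : Finset X) {ε : ℝ} (hε : 0 < ε) :
    ∃ m, ∀ x ∈ F, ∃ y ∈ S m, dist x y < ε := by
  have happrox : ∀ x ∈ F, ∀ᶠ m in atTop, ∃ y ∈ S m, dist x y < ε := fun x _ => by
    obtain ⟨y, hy, hxy⟩ := Metric.mem_closure_iff.1 (hd x) ε hε
    obtain ⟨m, hm⟩ := Set.mem_iUnion.1 hy
    filter_upwards [eventually_ge_atTop m] with k hk using ⟨y, hS hk hm, hxy⟩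
  exact ((Filter.eventually_all_finset F).2 happrox).exists

namespace Tower

variable {E : Type u} [CStarAlgebra E] (T : Tower E)

theorem norm_iterHom_step {m n : ℕ} (h : m ≤ n) (x : T.A m) : ‖iterHom T.step h x‖ = ‖x‖ := by
  induction n, h using Nat.le_induction with
  | base => rw [iterHom_self]
  | succ n h ih =>
    rw [iterHom_succ _ h, NonUnitalStarAlgHom.norm_map (T.step n) (T.step_injective n), ih]

theorem iterHom_step_mem {m n k : ℕ} (h : m ≤ n) {x : T.A m} (hx : x ∈ T.G m k) :
    iterHom T.step h x ∈ T.G n k := by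
  induction n, h using Nat.le_induction with
  | base => rwa [iterHom_self]
  | succ n h ih => rw [iterHom_succ _ h]; exact T.step_mem n k ih

theorem scalar_injective (m : ℕ) : Function.Injective (T.scalar m) :=
  (T.iso m).symm.injective.comp scalarMatrix_injective

section Corner

variable {B : Type*} [CStarAlgebra B] (θ : ∀ m, T.A m →⋆ₐ[ℂ] B)

/-- For a compatible sequence `θ` of homomorphisms out of the stages of a tower, the
homomorphism `x ↦ π_m(x) ⊗ 1` of the `m`-th stage onto a finite dimensional subalgebra of the
common target; its range is the subalgebra asked for in the definition of a Popa algebra. -/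
noncomputable def corner (m : ℕ) : T.A m →⋆ₙₐ[ℂ] B :=
  ((θ (m + 1)).comp (T.scalar m)).toNonUnitalStarAlgHom.comp (T.rep m)

theorem norm_corner_one_le (m : ℕ) : ‖T.corner θ m 1‖ ≤ 1 :=
  (NonUnitalStarAlgHom.norm_apply_le _ _).trans CStarRing.norm_one.le

theorem finiteDimensional_range_corner (m : ℕ) :
    FiniteDimensional ℂ (NonUnitalStarAlgHom.range (T.corner θ m)) := by
  let L : CStarMatrix (Fin (2 ^ T.l m)) (Fin (2 ^ T.l m)) ℂ →ₗ[ℂ] B :=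
    ((θ (m + 1)).comp (T.scalar m)).toAlgHom.toLinearMap
  have : FiniteDimensional ℂ (CStarMatrix (Fin (2 ^ T.l m)) (Fin (2 ^ T.l m)) ℂ) :=
    inferInstanceAs (FiniteDimensional ℂ (Matrix (Fin (2 ^ T.l m)) (Fin (2 ^ T.l m)) ℂ))
  have hle : (NonUnitalStarAlgHom.range (T.corner θ m)).toSubmodule ≤ LinearMap.range L := by
    rintro _ ⟨a, rfl⟩
    exact ⟨T.rep m a, rfl⟩
  exact Submodule.finiteDimensional_of_le hle

variable {θ} (hθ : ∀ m x, θ (m + 1) (T.step m x) = θ m x)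
include hθ

theorem corner_one_mul (m : ℕ) (a : T.A m) : T.corner θ m 1 * θ m a = T.corner θ m a := by
  change θ (m + 1) (T.scalar m (T.rep m 1)) * _ = θ (m + 1) (T.scalar m (T.rep m a))
  rw [← hθ m a, ← map_mul, T.scalar_mul_step]

theorem mul_corner_one (m : ℕ) (a : T.A m) : θ m a * T.corner θ m 1 = T.corner θ m a := by
  change _ * θ (m + 1) (T.scalar m (T.rep m 1)) = θ (m + 1) (T.scalar m (T.rep m a))
  rw [← hθ m a, ← map_mul, T.step_mul_scalar]

theorem norm_corner_one_mul_sub_mul_le (m : ℕ) (x : B) (a : T.A m) :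
    ‖T.corner θ m 1 * x - x * T.corner θ m 1‖ ≤ 2 * ‖x - θ m a‖ := by
  have hcomm : T.corner θ m 1 * x - x * T.corner θ m 1 =
      T.corner θ m 1 * (x - θ m a) - (x - θ m a) * T.corner θ m 1 := by
    rw [mul_sub, sub_mul, T.corner_one_mul hθ, T.mul_corner_one hθ, sub_sub_sub_cancel_right]
  have hleft : ‖T.corner θ m 1 * (x - θ m a)‖ ≤ 1 * ‖x - θ m a‖ :=
    norm_mul_le_of_le (T.norm_corner_one_le θ m) le_rfl
  have hright : ‖(x - θ m a) * T.corner θ m 1‖ ≤ ‖x - θ m a‖ * 1 :=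
    norm_mul_le_of_le le_rfl (T.norm_corner_one_le θ m)
  rw [hcomm]
  linarith [norm_sub_le (T.corner θ m 1 * (x - θ m a)) ((x - θ m a) * T.corner θ m 1)]

theorem norm_corner_one_mul_mul_sub_le (m : ℕ) (x : B) (a : T.A m) :
    ‖T.corner θ m 1 * x * T.corner θ m 1 - T.corner θ m a‖ ≤ ‖x - θ m a‖ := by
  have hcompress : T.corner θ m 1 * x * T.corner θ m 1 - T.corner θ m a =
      T.corner θ m 1 * (x - θ m a) * T.corner θ m 1 := by
    rw [mul_sub, sub_mul, T.corner_one_mul hθ, ← map_mul, mul_one]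
  have hle := norm_mul_le_of_le
    (norm_mul_le_of_le (T.norm_corner_one_le θ m) (le_refl ‖x - θ m a‖)) (T.norm_corner_one_le θ m)
  rwa [one_mul, mul_one, ← hcompress] at hle

theorem one_mem_of_norm_sub_lt_of_mem {I : TwoSidedIdeal B} {y : B} (hy : y ∈ I) {m : ℕ}
    {x : T.A m} (hx : x ∈ T.G m m) (h : ‖y - θ m x‖ < ‖x‖ / 2) : 1 ∈ I := by
  refine one_mem_of_norm_sub_map_matrix_lt ((θ (m + 1)).comp (T.scalar m))
    (I.mul_mem_left (T.corner θ m 1) y hy) (M := T.rep m x) ?_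
  change ‖_ - T.corner θ m x‖ < _
  rw [← T.corner_one_mul hθ m x, ← mul_sub]
  calc ‖T.corner θ m 1 * (y - θ m x)‖ ≤ 1 * ‖y - θ m x‖ :=
        norm_mul_le_of_le (T.norm_corner_one_le θ m) le_rfl
    _ < ‖T.rep m x‖ := by linarith [T.norm_le m x hx]

theorem one_mem_of_norm_sub_lt {I : TwoSidedIdeal B} {y : B} (hy : y ∈ I) {m : ℕ} {x : T.A m}
    (h : ‖y - θ m x‖ < ‖x‖ / 8) : 1 ∈ I := by
  have hx : 0 < ‖x‖ := by linarith [norm_nonneg (y - θ m x)]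
  obtain ⟨x', hx', hdist⟩ := Metric.mem_closure_iff.1 (T.dense m x) (‖x‖ / 8) (by positivity)
  obtain ⟨k, hk⟩ := Set.mem_iUnion.1 hx'
  rw [dist_eq_norm] at hdist
  refine T.one_mem_of_norm_sub_lt_of_mem hθ hy
    (T.mono _ (le_max_right m k) (T.iterHom_step_mem (le_max_left m k) hk)) ?_
  rw [map_iterHom T.step (F := fun m => θ m) hθ, T.norm_iterHom_step]
  have hsub : y - θ m x' = (y - θ m x) + θ m (x - x') := by rw [map_sub, sub_add_sub_cancel]
  have hθx : ‖θ m (x - x')‖ ≤ ‖x - x'‖ := NonUnitalStarAlgHom.norm_apply_le (θ m) _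
  rw [hsub]
  linarith [norm_add_le (y - θ m x) (θ m (x - x')), norm_sub_norm_le x x']

variable [Nontrivial B]

theorem map_injective (m : ℕ) : Function.Injective (θ m) := by
  rw [injective_iff_map_eq_zero]
  intro x hx
  by_contra hne
  have hone : (1 : B) ∈ (⊥ : TwoSidedIdeal B) := by
    refine T.one_mem_of_norm_sub_lt hθ (zero_mem _) (x := x) ?_
    rw [hx, sub_zero, norm_zero]
    have := norm_pos_iff.2 hne
    positivity
  exact one_ne_zero ((TwoSidedIdeal.mem_bot _).1 hone)

theorem corner_one_ne_zero (m : ℕ) : T.corner θ m 1 ≠ 0 := by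
  change θ (m + 1) (T.scalar m (T.rep m 1)) ≠ 0
  rw [map_ne_zero_iff _ (T.map_injective hθ _), map_ne_zero_iff _ (T.scalar_injective m)]
  exact T.rep_one m

variable (hd : Dense (⋃ m, Set.range (θ m)))
include hd

theorem isSimpleCStarAlgebra_of_dense : IsSimpleCStarAlgebra B := by
  refine ⟨inferInstance, fun I _ => or_iff_not_imp_left.2 fun hI => ?_⟩
  obtain ⟨a, ha, ha0⟩ : ∃ a ∈ I, a ≠ 0 := by
    by_contra! h
    exact hI (le_bot_iff.1 fun a ha => (TwoSidedIdeal.mem_bot _).2 (h a ha))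
  have hpos : 0 < ‖a‖ := norm_pos_iff.2 ha0
  obtain ⟨b, hb, hab⟩ := Metric.mem_closure_iff.1 (hd a) (‖a‖ / 16) (by positivity)
  obtain ⟨m, x, rfl⟩ := Set.mem_iUnion.1 hb
  rw [dist_eq_norm] at hab
  have hθx : ‖θ m x‖ ≤ ‖x‖ := NonUnitalStarAlgHom.norm_apply_le (θ m) x
  refine (TwoSidedIdeal.one_mem_iff I).1 (T.one_mem_of_norm_sub_lt hθ ha (x := x) ?_)
  linarith [norm_sub_norm_le a (θ m x)]

theorem isPopaAlgebra_of_dense : IsPopaAlgebra B where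
  simple := T.isSimpleCStarAlgebra_of_dense hθ hd
  separable := by
    rw [← TopologicalSpace.isSeparable_univ_iff, ← hd.closure_eq]
    exact (TopologicalSpace.IsSeparable.iUnion fun m => TopologicalSpace.isSeparable_range
      (NonUnitalStarAlgHom.isometry (θ m) (T.map_injective hθ m)).continuous).closure
  finite_dimensional_approximation F ε hε := by
    have hmono : Monotone fun m => Set.range (θ m) := by
      rintro m n h _ ⟨x, rfl⟩
      exact ⟨_, map_iterHom T.step (F := fun m => θ m) hθ h x⟩
    obtain ⟨m, hm⟩ := exists_forall_mem_dist_lt_of_dense hmono hd F (half_pos hε)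
    refine ⟨NonUnitalStarAlgHom.range (T.corner θ m), T.corner θ m 1,
      T.finiteDimensional_range_corner θ m, T.corner_one_ne_zero hθ m, ⟨1, rfl⟩, ?_,
      fun x hx => ?_, fun x hx => ?_⟩
    · rintro _ ⟨a, rfl⟩
      change T.corner θ m 1 * T.corner θ m a = T.corner θ m a ∧
        T.corner θ m a * T.corner θ m 1 = T.corner θ m a
      rw [← map_mul, ← map_mul, one_mul, mul_one]
      exact ⟨rfl, rfl⟩
    · obtain ⟨_, ⟨a, rfl⟩, ha⟩ := hm x hx
      rw [dist_eq_norm] at ha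
      linarith [T.norm_corner_one_mul_sub_mul_le hθ m x a]
    · obtain ⟨_, ⟨a, rfl⟩, ha⟩ := hm x hx
      rw [dist_eq_norm] at ha
      exact ⟨T.corner θ m a, ⟨a, rfl⟩,
        (T.norm_corner_one_mul_mul_sub_le hθ m x a).trans (ha.le.trans (half_le_self hε.le))⟩

end Corner

end Tower

section LpInfty

variable {ι : Type*} {B : ι → Type*} [∀ i, CStarAlgebra (B i)] [∀ i, Nontrivial (B i)]

noncomputable instance : CStarAlgebra (lp B ∞) where

/-- The unital `⋆`-homomorphism into a bounded product of unital C⋆-algebras with given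
components. -/
noncomputable def lpInftyLift {A : Type*} [CStarAlgebra A] (f : ∀ i, A →⋆ₐ[ℂ] B i) :
    A →⋆ₐ[ℂ] lp B ∞ where
  __ := lpInftyProd fun i => (f i).toNonUnitalStarAlgHom
  map_one' := by ext i; exact map_one (f i)
  commutes' c := by ext i; exact AlgHomClass.commutes (f i) c

/-- The `i`-th coordinate of a bounded product, as a `⋆`-homomorphism. -/
noncomputable def lpInftyEval (i : ι) : lp B ∞ →⋆ₐ[ℂ] B i where
  toFun x := x i
  map_one' := rfl
  map_mul' _ _ := rfl
  map_zero' := rfl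
  map_add' _ _ := rfl
  commutes' _ := rfl
  map_star' _ := rfl

end LpInfty

section InductiveLimit

variable {A : ℕ → Type u} [∀ m, CStarAlgebra (A m)] (φ : ∀ m, A m →⋆ₐ[ℂ] A (m + 1))

theorem exists_closure_iUnion_range {B : Type*} [CStarAlgebra B] {f : ∀ m, A m →⋆ₐ[ℂ] B}
    (hf : ∀ m x, f (m + 1) (φ m x) = f m x) :
    ∃ (L : StarSubalgebra ℂ B) (Θ : ∀ m, A m →⋆ₐ[ℂ] L), IsClosed (L : Set B) ∧
      (∀ m x, (Θ m x : B) = f m x) ∧ Dense (⋃ m, Set.range (Θ m)) := by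
  have hmono : Monotone fun m => (f m).range := by
    refine monotone_nat_of_le_succ fun m => ?_
    rintro _ ⟨x, rfl⟩
    exact ⟨φ m x, hf m x⟩
  let S : StarSubalgebra ℂ B := ⨆ m, (f m).range
  have hS : (S : Set B) = ⋃ m, ((f m).range : Set B) :=
    StarSubalgebra.coe_iSup_of_directed hmono.directed_le
  have hmem (m : ℕ) (x : A m) : f m x ∈ S.topologicalClosure :=
    S.le_topologicalClosure (le_iSup (fun m => (f m).range) m ⟨x, rfl⟩)
  refine ⟨S.topologicalClosure, fun m => (f m).codRestrict _ (hmem m),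
    S.isClosed_topologicalClosure, fun _ _ => rfl, fun z => ?_⟩
  have hz : (z : B) ∈ closure (S : Set B) := z.2
  rw [closure_subtype]
  refine closure_mono ?_ hz
  rw [hS]
  intro w hw
  obtain ⟨m, x, rfl⟩ := Set.mem_iUnion.1 hw
  exact ⟨⟨f m x, hmem m x⟩, Set.mem_iUnion.2 ⟨m, x, rfl⟩, rfl⟩

theorem exists_limit_of_representations {ι : Type u} [Nonempty ι] {B : ι → Type u}
    [∀ i, CStarAlgebra (B i)] [∀ i, Nontrivial (B i)] {θ : ∀ i m, A m →⋆ₐ[ℂ] B i}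
    (hθ : ∀ i m x, θ i (m + 1) (φ m x) = θ i m x) :
    ∃ (L : Type u) (_ : CStarAlgebra L) (Θ : ∀ m, A m →⋆ₐ[ℂ] L) (ev : ∀ i, L →⋆ₐ[ℂ] B i),
      Nontrivial L ∧ (∀ m x, Θ (m + 1) (φ m x) = Θ m x) ∧
      Dense (⋃ m, Set.range (Θ m)) ∧ ∀ i m x, ev i (Θ m x) = θ i m x := by
  have hf (m : ℕ) (x : A m) :
      lpInftyLift (fun i => θ i (m + 1)) (φ m x) = lpInftyLift (fun i => θ i m) x := by
    ext i
    exact hθ i m x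
  obtain ⟨L, Θ, hL, hΘ, hd⟩ := exists_closure_iUnion_range φ
    (B := lp B ∞) (f := fun m => lpInftyLift fun i => θ i m) hf
  have : IsClosed (L : Set (lp B ∞)) := hL
  let ev (i : ι) : L →⋆ₐ[ℂ] B i := (lpInftyEval i).comp L.subtype
  refine ⟨L, inferInstance, Θ, ev, (ev (Classical.arbitrary ι)).toRingHom.domain_nontrivial,
    fun m x => Subtype.ext ?_, hd, fun i m x => ?_⟩
  · rw [hΘ, hΘ, hf]
  · change (Θ m x : lp B ∞) i = _
    rw [hΘ]
    rfl

end InductiveLimit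

section Dense

variable {L : Type*} [CStarAlgebra L]

theorem continuous_starAlgHom {B : Type*} [CStarAlgebra B] (f : L →⋆ₐ[ℂ] B) : Continuous f :=
  AddMonoidHomClass.continuous_of_bound f 1 fun x => by
    rw [one_mul]
    exact NonUnitalStarAlgHom.norm_apply_le f x

theorem centralizer_range_eq_centralizer_image_of_dense {B : Type*} [CStarAlgebra B]
    (f : L →⋆ₐ[ℂ] B) {D : Set L} (hD : Dense D) :
    (Set.range f).centralizer = (f '' D).centralizer := by
  refine (Set.centralizer_subset (Set.image_subset_range f D)).antisymm fun b hb => ?_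
  rintro _ ⟨a, rfl⟩
  have hf := continuous_starAlgHom f
  exact closure_minimal (fun a ha => hb _ ⟨a, ha, rfl⟩ : D ⊆ {a | f a * b = b * f a})
    (isClosed_eq (hf.mul continuous_const) (continuous_const.mul hf)) (hD a)

variable {H : Type*} [NormedAddCommGroup H] [InnerProductSpace ℂ H] [CompleteSpace H]

theorem IsTraceVector.of_dense {A : ℕ → Type*} [∀ m, CStarAlgebra (A m)]
    {φ : ∀ m, A m →⋆ₐ[ℂ] A (m + 1)} {Θ : ∀ m, A m →⋆ₐ[ℂ] L}
    (hΘ : ∀ m x, Θ (m + 1) (φ m x) = Θ m x) (hd : Dense (⋃ m, Set.range (Θ m)))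
    {ρ : L →⋆ₐ[ℂ] (H →L[ℂ] H)} {Ω : H} (h : ∀ m, IsTraceVector (ρ.comp (Θ m)) Ω) :
    IsTraceVector ρ Ω := by
  have hρ : Continuous ρ := continuous_starAlgHom (B := H →L[ℂ] H) ρ
  have hc : Continuous fun p : L × L => inner ℂ Ω (ρ (p.1 * p.2) Ω) :=
    continuous_const.inner ((hρ.comp continuous_mul).clm_apply continuous_const)
  have heq : Set.EqOn (fun p : L × L => inner ℂ Ω (ρ (p.1 * p.2) Ω))
      (fun p => inner ℂ Ω (ρ (p.2 * p.1) Ω))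
      ((⋃ m, Set.range (Θ m)) ×ˢ (⋃ m, Set.range (Θ m))) := by
    rintro ⟨_, _⟩ ⟨ha, hb⟩
    obtain ⟨m, x, rfl⟩ := Set.mem_iUnion.1 ha
    obtain ⟨k, y, rfl⟩ := Set.mem_iUnion.1 hb
    dsimp only
    rw [← map_iterHom φ (F := fun m => Θ m) hΘ (le_max_left m k) x,
      ← map_iterHom φ (F := fun m => Θ m) hΘ (le_max_right m k) y, ← map_mul (Θ _),
      ← map_mul (Θ _)]
    exact h _ _ _
  exact fun a b => congrFun (Continuous.ext_on (hd.prod hd) hc (hc.comp continuous_swap) heq) (a, b)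

end Dense

theorem star_eq_of_forall_star_mem {α : Type*} [InvolutiveStar α] {S : Set α}
    (h : ∀ x ∈ S, star x ∈ S) : star S = S :=
  Set.ext fun x => ⟨fun hx => star_star x ▸ h _ hx, h x⟩

section TracialStates

variable {A : Type u} [CStarAlgebra A] [PartialOrder A] [StarOrderedRing A]

/-- The positive functional given by a linear functional which is nonnegative on the elements
`star b * b`. -/
noncomputable def positiveFunctional (f : A →ₗ[ℂ] ℂ) (hf : ∀ b, 0 ≤ f (star b * b)) : A →ₚ[ℂ] ℂ :=
  PositiveLinearMap.mk₀ f fun a ha => by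
    obtain ⟨b, rfl⟩ := CStarAlgebra.nonneg_iff_eq_star_mul_self.1 ha
    exact hf b

theorem IsResiduallyFiniteDimensional.nonempty_tracialState [Nontrivial A]
    (hA : IsResiduallyFiniteDimensional A) : Nonempty (TracialState A) := by
  obtain ⟨n, π, hπ⟩ := hA 1 one_ne_zero
  have hnonneg (b : A) : 0 ≤ (π (star b * b)).trace := by
    rw [map_mul, map_star]
    exact (Matrix.posSemidef_conjTranspose_mul_self (π b)).trace_nonneg
  have hone : 0 ≤ (π 1).trace := by simpa using hnonneg 1
  have hne : (π 1).trace ≠ 0 := by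
    intro h
    refine hπ (Matrix.trace_conjTranspose_mul_self_eq_zero_iff.1 ?_)
    rw [← h, ← Matrix.star_eq_conjTranspose, ← map_star, ← map_mul, star_one, one_mul]
  let f : A →ₗ[ℂ] ℂ := (π 1).trace⁻¹ • Matrix.traceLinearMap (Fin n) ℂ ℂ ∘ₗ (π : A →ₗ[ℂ] _)
  have hf (a : A) : f a = (π 1).trace⁻¹ * (π a).trace := rfl
  refine ⟨⟨positiveFunctional f fun b => mul_nonneg (inv_nonneg.2 hone) (hnonneg b),
    inv_mul_cancel₀ hne, fun x y => ?_⟩⟩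
  change f (x * y) = f (y * x)
  rw [hf, hf, map_mul, map_mul, Matrix.trace_mul_comm]

/-- The tracial state given by a unit trace vector of a representation. -/
noncomputable def TracialState.ofVector {H : Type*} [NormedAddCommGroup H] [InnerProductSpace ℂ H]
    [CompleteSpace H] {ρ : A →⋆ₐ[ℂ] (H →L[ℂ] H)} {Ω : H} (hΩ : ‖Ω‖ = 1)
    (htrace : IsTraceVector ρ Ω) : TracialState A where
  toFunctional := positiveFunctional
    (innerₛₗ ℂ Ω ∘ₗ (ContinuousLinearMap.apply ℂ H Ω).toLinearMap ∘ₗ ρ.toAlgHom.toLinearMap)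
    fun b => by
      change 0 ≤ inner ℂ Ω (ρ (star b * b) Ω)
      rw [← inner_starAlgHom_apply_apply (H := H) ρ Ω b b, inner_self_eq_norm_sq_to_K,
        ← RCLike.ofReal_pow]
      exact Complex.zero_le_real.2 (sq_nonneg _)
  map_one := by
    change inner ℂ Ω (ρ 1 Ω) = 1
    rw [_root_.map_one, one_apply_eq_self, inner_self_eq_norm_sq_to_K, hΩ]
    simp
  map_mul_comm := htrace

end TracialStates

section LimitOfTower

variable {E : Type u} [CStarAlgebra E]

namespace Tower

variable (T : Tower E)

/-- The embedding of `E` into the `m`-th stage as constant diagonal matrices. -/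
noncomputable def baseAmp (m : ℕ) : E →⋆ₐ[ℂ] T.A m :=
  (iterHom T.amp (Nat.zero_le m)).comp T.base.toStarAlgHom

theorem baseAmp_zero (x : E) : T.baseAmp 0 x = T.base x := iterHom_self T.amp 0 (T.base x)

theorem baseAmp_succ (m : ℕ) (x : E) : T.baseAmp (m + 1) x = T.amp m (T.baseAmp m x) :=
  iterHom_succ T.amp (Nat.zero_le m) (T.base x)

theorem baseAmp_injective (m : ℕ) : Function.Injective (T.baseAmp m) := by
  induction m with
  | zero =>
    intro x y h
    rw [baseAmp_zero, baseAmp_zero] at h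
    exact T.base.injective h
  | succ m ih =>
    intro x y h
    rw [baseAmp_succ, baseAmp_succ] at h
    exact ih (T.amp_injective m h)

end Tower

namespace PauliRep

variable {H : Type u} [NormedAddCommGroup H] [InnerProductSpace ℂ H] [CompleteSpace H]
  (P : PauliRep E H) (T : Tower E)

theorem stage_baseAmp (m : ℕ) (x : E) : P.stage T m (T.baseAmp m x) = P.π x := by
  induction m with
  | zero => rw [T.baseAmp_zero, P.stage_zero]
  | succ m ih => rw [T.baseAmp_succ, P.stage_amp, ih]

variable {Ω : H}

theorem norm_inner_limit_baseAmp_sub_le (hΩ : Ω ∈ P.V 0) (hΩ_norm : ‖Ω‖ = 1) (m : ℕ) (x : E) :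
    ‖inner ℂ Ω ((P.asymptoticRep T).limit m (T.baseAmp m x) Ω) - inner ℂ Ω (P.π x Ω)‖ ≤
      2 * (1 / 2) ^ m * ‖x‖ := by
  rw [← P.stage_baseAmp T m x, ← inner_sub_right]
  refine (norm_inner_le_norm _ _).trans ?_
  rw [hΩ_norm, one_mul]
  refine (P.norm_limit_apply_sub_le T hΩ m _).trans ?_
  rw [hΩ_norm, mul_one, mul_comm]
  exact mul_le_mul_of_nonneg_left (NonUnitalStarAlgHom.norm_apply_le (T.baseAmp m) x)
    (by positivity)

variable {L : Type u} [CStarAlgebra L] {Θ : ∀ m, T.A m →⋆ₐ[ℂ] L} {ev : L →⋆ₐ[ℂ] (H →L[ℂ] H)}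

theorem centralizer_range_of_dense (hd : Dense (⋃ m, Set.range (Θ m)))
    (hev : ∀ m x, ev (Θ m x) = (P.asymptoticRep T).limit m x) :
    (Set.range ev).centralizer = P.generators.centralizer := by
  rw [centralizer_range_eq_centralizer_image_of_dense (B := H →L[ℂ] H) ev hd, Set.image_iUnion,
    ← P.centralizer_iUnion_range_limit T]
  simp only [← Set.range_comp, Function.comp_def, hev]

theorem exists_tracialState_isomorphic [PartialOrder L] [StarOrderedRing L] (hΩ : Ω ∈ P.V 0)
    (hΩ_norm : ‖Ω‖ = 1) (htrace : IsTraceVector P.π Ω) (hcyclic : IsCyclicVector P.generators Ω)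
    (hΘ : ∀ m x, Θ (m + 1) (T.step m x) = Θ m x) (hd : Dense (⋃ m, Set.range (Θ m)))
    (hev : ∀ m x, ev (Θ m x) = (P.asymptoticRep T).limit m x) :
    ∃ γ : TracialState L,
      (∀ m x, ‖γ.toFunctional (Θ m (T.baseAmp m x)) - inner ℂ Ω (P.π x Ω)‖ ≤
        2 * (1 / 2) ^ m * ‖x‖) ∧
      γ.gnsVonNeumannAlgebra.Isomorphic (vonNeumannAlgebraGenerated P.generators) := by
  have hev_trace : IsTraceVector ev Ω := .of_dense hΘ hd fun m x y => by
    simpa only [StarAlgHom.comp_apply, hev] using P.isTraceVector_limit T hΩ htrace m x y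
  have hcentralizer := P.centralizer_range_of_dense T hd hev
  have hstar : ∀ S ∈ Set.range ev, star S ∈ Set.range ev := by
    rintro _ ⟨a, rfl⟩
    exact ⟨star a, map_star ev a⟩
  have hdense : DenseRange fun a => ev a Ω :=
    (hcyclic.of_centralizer_subset hstar hcentralizer.subset).denseRange_apply
  let γ : TracialState L := .ofVector hΩ_norm hev_trace
  refine ⟨γ, fun m x => ?_, ?_⟩
  · change ‖inner ℂ Ω (ev (Θ m (T.baseAmp m x)) Ω) - _‖ ≤ _
    rw [hev]
    exact P.norm_inner_limit_baseAmp_sub_le T hΩ hΩ_norm m x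
  · obtain ⟨e, he⟩ := exists_conjStarAlgEquiv_of_inner_eq
      (denseRange_gnsStarAlgHom_apply_gnsVector γ.toFunctional) hdense
      (inner_gnsVector γ.toFunctional)
    have hgen : vonNeumannAlgebraGenerated (Set.range ev) =
        vonNeumannAlgebraGenerated P.generators :=
      vonNeumannAlgebraGenerated_congr (star_eq_of_forall_star_mem hstar)
        (star_eq_of_forall_star_mem fun _ => P.star_mem_generators) hcentralizer
    have himage : e.conjStarAlgEquiv '' Set.range γ.toFunctional.gnsStarAlgHom = Set.range ev := by
      rw [← Set.range_comp]
      exact congrArg Set.range (funext he)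
    rw [← hgen, ← himage]
    exact isomorphic_vonNeumannAlgebraGenerated_image_conj e _

end PauliRep

end LimitOfTower

namespace TracialState

variable {E : Type u} [CStarAlgebra E] [PartialOrder E] [StarOrderedRing E] (τ : TracialState E)

/-- The Pauli system of `R` and the GNS representation of `τ`, on `L²(R) ⊗ L²(E, τ)`. -/
noncomputable def pauliRep : PauliRep E (HilbertTensor PauliSpace τ.toFunctional.GNS) :=
  pauliSystem.tensorRep τ.toFunctional.gnsStarAlgHom

/-- The trace vector of `R ⊗̄ π_τ(E)''`. -/
noncomputable def tensorVector : HilbertTensor PauliSpace τ.toFunctional.GNS :=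
  hilbertTmul pauliVector (gnsVector τ.toFunctional)

theorem norm_tensorVector : ‖τ.tensorVector‖ = 1 := by
  refine norm_eq_one_of_inner_self_eq_one ?_
  rw [tensorVector, inner_hilbertTmul, inner_self_eq_norm_sq_to_K, inner_self_eq_norm_sq_to_K,
    norm_pauliVector, τ.norm_gnsVector]
  simp

instance : Nontrivial (HilbertTensor PauliSpace τ.toFunctional.GNS) :=
  ⟨τ.tensorVector, 0, norm_ne_zero_iff.1 (τ.norm_tensorVector.trans_ne one_ne_zero)⟩

theorem tensorVector_mem : τ.tensorVector ∈ τ.pauliRep.V 0 :=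
  hilbertTmul_mem_tensorSubspace pauliVector_mem _

theorem inner_tensorVector (x : E) :
    inner ℂ τ.tensorVector (τ.pauliRep.π x τ.tensorVector) = τ.toFunctional x := by
  change inner ℂ (hilbertTmul pauliVector (gnsVector τ.toFunctional)) (operatorTensor 1
    (τ.toFunctional.gnsStarAlgHom x) (hilbertTmul pauliVector (gnsVector τ.toFunctional))) = _
  rw [operatorTensor_hilbertTmul, inner_hilbertTmul, inner_gnsVector, one_apply_eq_self,
    inner_self_eq_norm_sq_to_K, norm_pauliVector]
  simp

theorem isTraceVector_tensorVector : IsTraceVector τ.pauliRep.π τ.tensorVector := fun x y => by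
  rw [inner_tensorVector, inner_tensorVector, τ.map_mul_comm]

theorem isCyclicVector_tensorVector : IsCyclicVector τ.pauliRep.generators τ.tensorVector :=
  pauliSystem.isCyclicVector_tensorRep _ isCyclicVector_pauliVector
    (denseRange_gnsStarAlgHom_apply_gnsVector τ.toFunctional)

theorem vonNeumannAlgebraGenerated_generators_pauliRep :
    vonNeumannAlgebraGenerated τ.pauliRep.generators =
      hyperfiniteFactor.tensor τ.gnsVonNeumannAlgebra := by
  rw [hyperfiniteFactor, gnsVonNeumannAlgebra, tensor_vonNeumannAlgebraGenerated, Set.image_union,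
    ← Set.range_comp, ← Set.range_comp, ← Set.range_comp]
  rfl

end TracialState

theorem mainTheorem3
    (C : ∀ (B : Type u) [CStarAlgebra B], Prop)
    (hC_union : ClosedUnderIncreasingUnions C)
    (hC_matrix : ClosedUnderMatrixTensoring C)
    (E : Type u) [CStarAlgebra E] [PartialOrder E] [StarOrderedRing E]
    [Nontrivial E] [TopologicalSpace.SeparableSpace E]
    (hE_mem : C E) (hE_rfd : IsResiduallyFiniteDimensional E) :
    ∃ (A : Type u) (_ : CStarAlgebra A) (_ : PartialOrder A) (_ : StarOrderedRing A),
      IsPopaAlgebra A ∧ C A ∧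
      ∀ ε : ℝ, 0 < ε → ∃ ρ : E →⋆ₐ[ℂ] A, Function.Injective ρ ∧
        ∀ τ : TracialState E, ∃ γ : TracialState A,
          (∀ x : E, x ≠ 0 → ‖γ.toFunctional (ρ x) - τ.toFunctional x‖ < ε * ‖x‖) ∧
          γ.gnsVonNeumannAlgebra.Isomorphic
            (hyperfiniteFactor.tensor τ.gnsVonNeumannAlgebra) := by
  obtain ⟨T⟩ := hE_rfd.nonempty_tower
  have := hE_rfd.nonempty_tracialState
  obtain ⟨A, _, Θ, ev, _, hΘ, hd, hev⟩ := exists_limit_of_representations T.step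
    (θ := fun τ : TracialState E => (τ.pauliRep.asymptoticRep T).limit)
    fun τ => (τ.pauliRep.asymptoticRep T).limit_succ
  let _ := CStarAlgebra.spectralOrder A
  have := CStarAlgebra.spectralOrderedRing A
  have hΘ_injective := T.map_injective hΘ
  have hΘ_mono (m : ℕ) : Set.range (Θ m) ⊆ Set.range (Θ (m + 1)) := by
    rintro _ ⟨x, rfl⟩
    exact ⟨T.step m x, hΘ m x⟩
  refine ⟨A, inferInstance, inferInstance, inferInstance, T.isPopaAlgebra_of_dense hΘ hd,
    hC_union T.A A Θ hΘ_injective hΘ_mono hd (T.mem_class hC_union hC_matrix hE_mem),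
    fun ε hε => ?_⟩
  obtain ⟨m, hm⟩ := exists_pow_lt_of_lt_one (half_pos hε) (by norm_num : (1 / 2 : ℝ) < 1)
  refine ⟨(Θ m).comp (T.baseAmp m), (hΘ_injective m).comp (T.baseAmp_injective m), fun τ => ?_⟩
  obtain ⟨γ, hγ, hiso⟩ := τ.pauliRep.exists_tracialState_isomorphic T τ.tensorVector_mem
    τ.norm_tensorVector τ.isTraceVector_tensorVector τ.isCyclicVector_tensorVector hΘ hd (hev τ)
  rw [τ.vonNeumannAlgebraGenerated_generators_pauliRep] at hiso
  refine ⟨γ, fun x hx => ?_, hiso⟩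
  have hclose := hγ m x
  rw [τ.inner_tensorVector] at hclose
  exact hclose.trans_lt (mul_lt_mul_of_pos_right (by linarith) (norm_pos_iff.2 hx))
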